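/- **Theorem 4.1.** Let $(N,J_1,J_2,J_3,\omega_1,\omega_2,\omega_3,k)$ be a non-empty compact hyperKähler manifold of positive dimension, with $J_1J_2=J_3=-J_2J_1$ and $\omega_i(X,Y)=k(J_iX,Y)$. Let $\mathbb T^3=\Gamma\backslash\mathbb R^3$ be a 3-torus, $\Gamma\subset\mathbb R^3$ a lattice, with the coordinates $(x^1,x^2,x^3)$ induced from $\mathbb R^3$. Let $a_1,b_2,b_3$ be smooth real functions on $[0,1]$ such that for every $t\in[0,1]$ the vector fields $$e_1(t)=a_1\tfrac{\partial}{\partial x^1},\quad e_2(t)=b_2\tfrac{\partial}{\partial x^2}+b_3\tfrac{\partial}{\partial x^3},\quad e_3(t)=-b_3\tfrac{\partial}{\partial x^2}+b_2\tfrac{\partial}{\partial x^3}$$ form a basis, let $l=b_2^2+b_3^2$, and let $$e^1(t)=\tfrac1{a_1}dx^1,\quad e^2(t)=\tfrac{b_2}{l}dx^2+\tfrac{b_3}{l}dx^3,\quad e^3(t)=-\tfrac{b_3}{l}dx^2+\tfrac{b_2}{l}dx^3$$ be the dual basis. With $v=b_2b_2'+b_3b_3'$ and $w=b_2b_3'-b_3b_2'$,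 assume $$\frac{v(1)}{l(1)}=\frac{v(0)}{l(0)},\qquad \frac{w(1)}{l(1)}=\frac{w(0)}{l(0)},\qquad \Big(\frac1{l(t)}\Big)'\cdot\frac1{a_1(t)}=\mathrm{const}\neq0 .$$ Let $\rho$ be a diffeomorphism of $\mathbb T^3$ with $\rho^*\big(e^i(1)\big)=e^i(0)$ for $i=1,2,3$, and let $\psi$ be a diffeomorphism of $N$ which is holomorphic with respect to $J_1,J_2,J_3$ and satisfies $\psi^*\omega_i=\omega_i$ for $i=1,2,3$. Let $M_f$ be the mapping torus of $f=(\rho,\psi):\mathbb T^3\times N\to\mathbb T^3\times N$, i.e. the quotient of $\mathbb T^3\times N\times\mathbb R$ by the $\mathbb Z$-action generated by $(x,p,t)\mapsto(\rho(x),\psi(p),t+1)$. Then $M_f$ admits a non-split generalized Kähler structure $(I_\pm,g,\omega_\pm)$: a Riemannian metric $g$ and two integrable complex structures $I_+,I_-$ orthogonal for $g$, with fundamental forms $\omega_\pm(X,Y)=g(I_\pm X,Y)$, such that $d^c_+\omega_+=-d^c_-\omega_-$ is a closed $3$-form, where $d^c_\pm\omega_\pm=I_\pm^{-1}d\omega_\pm$,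 and $[I_+,I_-]\neq0$. Moreover it can be chosen such that on the tangent spaces of the fibres $\{[(x,p,t)]:p\in N\}\cong N$ one has $I_+=J_1$ and $I_-=J_2$, and such that the Poisson tensor $\tfrac12[I_+,I_-]g^{-1}:T^*M_f\to TM_f$ equals $-\omega_3^{-1}$. Here $\omega_3$ is regarded as the isomorphism $X\mapsto\omega_3(X,\cdot)$ from the tangent to the cotangent spaces of the fibre, and $\omega_3^{-1}$ is extended to $T^*M_f$ by first restricting covectors to the fibre. -/

import Mathlib

open scoped Manifold ContDiff Topology

noncomputable section

namespace GKTorus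

section Tensors

variable {E : Type*} [NormedAddCommGroup E] [NormedSpace ℝ E]
  {H : Type*} [TopologicalSpace H] (I : ModelWithCorners ℝ E H)
  (M : Type*) [TopologicalSpace M] [ChartedSpace H M]
  {E' : Type*} [NormedAddCommGroup E'] [NormedSpace ℝ E']
  {H' : Type*} [TopologicalSpace H'] {I' : ModelWithCorners ℝ E' H'}
  {M' : Type*} [TopologicalSpace M'] [ChartedSpace H' M']

/-- Fields of endomorphisms of the tangent bundle. -/
abbrev EndField := ∀ x : M, TangentSpace I x →L[ℝ] TangentSpace I x

/-- Fields of alternating `k`-forms on the tangent spaces. -/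
abbrev DForm (k : ℕ) := ∀ x : M, TangentSpace I x [⋀^Fin k]→L[ℝ] ℝ

/-- Smooth Riemannian metrics on `M`. -/
abbrev Metric [IsManifold I ∞ M] :=
  Bundle.ContMDiffRiemannianMetric I ∞ E (fun x : M => TangentSpace I x)

variable {I M}

/-- Smoothness of a field of endomorphisms, as a section of the bundle `Hom(TM, TM)`. -/
def SmoothEnd [IsManifold I ∞ M] (J : EndField I M) : Prop :=
  ContMDiff I (I.prod 𝓘(ℝ, E →L[ℝ] E)) ∞
    (fun x => Bundle.TotalSpace.mk' (E →L[ℝ] E)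
      (E := fun x : M => TangentSpace I x →L[ℝ] TangentSpace I x) x (J x))

/-- Pullback of a form by a map. -/
def pullback {k : ℕ} (F : M → M') (α : DForm I' M' k) : DForm I M k :=
  fun x => (α (F x)).compContinuousLinearMap (mfderiv I I' F x)

/-- The coordinate expression of a form in the chart at `x₀`: its pullback by the inverse of the
chart. -/
def chartForm {k : ℕ} (α : DForm I M k) (x₀ : M) : E → E [⋀^Fin k]→L[ℝ] ℝ := fun u =>
  (α ((extChartAt I x₀).symm u)).compContinuousLinearMap
    (mfderiv 𝓘(ℝ, E) I (extChartAt I x₀).symm u :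
      E →L[ℝ] TangentSpace I ((extChartAt I x₀).symm u))

/-- Exterior derivative on a manifold without boundary: at the point `x` it is computed in the
chart at `x`, as the exterior derivative of the coordinate expression of the form. -/
def extD {k : ℕ} (α : DForm I M k) : DForm I M (k + 1) := fun x =>
  (extDeriv (chartForm α x) (extChartAt I x x)).compContinuousLinearMap
    (mfderiv I 𝓘(ℝ, E) (extChartAt I x) x : TangentSpace I x →L[ℝ] E)

/-- The matrix of a field of endomorphisms in the chart at `x₀`. -/
def chartEnd (J : EndField I M) (x₀ : M) : E → E →L[ℝ] E := fun u =>
  (mfderiv I 𝓘(ℝ, E) (extChartAt I x₀) ((extChartAt I x₀).symm u) :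
      TangentSpace I ((extChartAt I x₀).symm u) →L[ℝ] E) ∘L
    J ((extChartAt I x₀).symm u) ∘L
    (mfderiv 𝓘(ℝ, E) I (extChartAt I x₀).symm u :
      E →L[ℝ] TangentSpace I ((extChartAt I x₀).symm u))

/-- The Nijenhuis tensor `N(X, Y) = [JX, JY] - J([JX, Y] + [X, JY]) - [X, Y]` of `J` at `x`,
evaluated on the coordinate fields `X = u`, `Y = v` (constant vectors) of the chart at `x`. -/
def nijenhuis (J : EndField I M) (x : M) (u v : E) : E :=
  let A := chartEnd J x
  let p := extChartAt I x x
  VectorField.lieBracket ℝ (fun y => A y u) (fun y => A y v) p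
    - A p (VectorField.lieBracket ℝ (fun y => A y u) (fun _ => v) p
      + VectorField.lieBracket ℝ (fun _ => u) (fun y => A y v) p)
    - VectorField.lieBracket ℝ (fun _ => u) (fun _ => v) p

/-- `J` is an (integrable) complex structure on `M`. -/
structure IsComplexStructure [IsManifold I ∞ M] (J : EndField I M) : Prop where
  smooth : SmoothEnd J
  sq : ∀ (x : M) (v : TangentSpace I x), J x (J x v) = -v
  integrable : ∀ (x : M) (u v : E), nijenhuis J x u v = 0

/-- `J` is orthogonal for `g` and `Ω(X, Y) = g(JX, Y)` is the fundamental form of `(g, J)`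
(equivalently, `-ΩJ = g` as maps `TM → T^*M`). -/
structure IsHermitian [IsManifold I ∞ M] (g : Metric I M) (J : EndField I M)
    (Ω : DForm I M 2) : Prop where
  orthogonal : ∀ (x : M) (u v : TangentSpace I x), g.inner x (J x u) (J x v) = g.inner x u v
  form : ∀ (x : M) (u v : TangentSpace I x), Ω x ![u, v] = g.inner x (J x u) v

/-- `d^c Ω = J⁻¹ dΩ`, that is, `d^c Ω (X, Y, Z) = dΩ (J⁻¹X, J⁻¹Y, J⁻¹Z)` with `J⁻¹ = -J`. -/
def dc (J : EndField I M) (Ω : DForm I M 2) : DForm I M 3 :=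
  fun x => (extD Ω x).compContinuousLinearMap (-(J x))

/-- `(J₁, J₂, J₃, Ω₁, Ω₂, Ω₃, k)` is a hyperKähler structure on `M`. -/
structure IsHyperkahler [IsManifold I ∞ M] (J₁ J₂ J₃ : EndField I M)
    (Ω₁ Ω₂ Ω₃ : DForm I M 2) (k : Metric I M) : Prop where
  complex₁ : IsComplexStructure J₁
  complex₂ : IsComplexStructure J₂
  complex₃ : IsComplexStructure J₃
  quaternion : ∀ (x : M) (v : TangentSpace I x), J₁ x (J₂ x v) = J₃ x v
  anticommute : ∀ (x : M) (v : TangentSpace I x), J₂ x (J₁ x v) = -J₃ x v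
  hermitian₁ : IsHermitian k J₁ Ω₁
  hermitian₂ : IsHermitian k J₂ Ω₂
  hermitian₃ : IsHermitian k J₃ Ω₃
  closed₁ : ∀ x, extD Ω₁ x = 0
  closed₂ : ∀ x, extD Ω₂ x = 0
  closed₃ : ∀ x, extD Ω₃ x = 0

/-- `(I₊, I₋, g, Ω₊, Ω₋)` is a generalized Kähler structure on `M`, in the bihermitian form:
`I₊`, `I₋` are complex structures orthogonal for `g`, with fundamental forms `Ω₊`, `Ω₋`, and
`d^c₊ Ω₊ = -d^c₋ Ω₋` is a closed 3-form. -/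
structure IsGeneralizedKahler [IsManifold I ∞ M] (Ip Im : EndField I M) (g : Metric I M)
    (Ωp Ωm : DForm I M 2) : Prop where
  complex_plus : IsComplexStructure Ip
  complex_minus : IsComplexStructure Im
  hermitian_plus : IsHermitian g Ip Ωp
  hermitian_minus : IsHermitian g Im Ωm
  torsion : ∀ x, dc Ip Ωp x = -dc Im Ωm x
  torsion_closed : ∀ x, extD (dc Ip Ωp) x = 0

/-- The commutator `[I₊, I₋]`. -/
def commutator (Ip Im : EndField I M) : EndField I M :=
  fun x => Ip x ∘L Im x - Im x ∘L Ip x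

/-- A generalized Kähler structure is split if `[I₊, I₋] = 0`, and non-split otherwise. -/
def IsSplit (Ip Im : EndField I M) : Prop := ∀ x, commutator Ip Im x = 0

/-- The Poisson tensor `½ [I₊, I₋] g⁻¹ : T^*M → TM`, where `g` is the isomorphism
`X ↦ g(X, ·)` from `TM` to `T^*M`. -/
def poissonTensor [IsManifold I ∞ M] (Ip Im : EndField I M) (g : Metric I M) (x : M) :
    (TangentSpace I x →L[ℝ] ℝ) →L[ℝ] TangentSpace I x :=
  (1 / 2 : ℝ) • (commutator Ip Im x ∘L (g.inner x).inverse)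

end Tensors

section QuotientManifold

variable {E : Type*} [NormedAddCommGroup E] [NormedSpace ℝ E]
  {H : Type*} [TopologicalSpace H] {I : ModelWithCorners ℝ E H}
  {X : Type*} [TopologicalSpace X] [ChartedSpace H X]
  {Y : Type*} [TopologicalSpace Y]

/-- The manifold structure pushed forward by a surjective local homeomorphism is smooth as soon
as two points of the same fibre are always exchanged by a smooth deck transformation. -/
theorem isManifold_of_deck [IsManifold I ∞ X] {q : X → Y} (hq : IsLocalHomeomorph q)
    (hs : Function.Surjective q)
    (deck : ∀ a b, q a = q b → ∃ φ : X → X, ContMDiff I I ∞ φ ∧ φ a = b ∧ ∀ z, q (φ z) = q z) :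
    @IsManifold ℝ _ E _ _ H _ I ∞ Y _ (hq.chartedSpace hs) := by
  let _ : ChartedSpace H Y := hq.chartedSpace hs
  apply isManifold_of_contDiffOn
  rintro _ _ ⟨y, rfl⟩ ⟨y', rfl⟩
  generalize hs.hasRightInverse.choose y = a
  generalize hs.hasRightInverse.choose y' = b
  rintro z ⟨hz, hzr⟩
  have hz' := hz
  simp only [OpenPartialHomeomorph.trans_source, OpenPartialHomeomorph.symm_source,
    OpenPartialHomeomorph.coe_trans, Set.mem_inter_iff, Set.mem_preimage, Function.comp_apply,
    OpenPartialHomeomorph.trans_symm_eq_symm_trans_symm,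
    IsLocalHomeomorph.localInverseAt_symm] at hz'
  obtain ⟨⟨h1, h2⟩, h3, h4⟩ := hz'
  set x := (chartAt H a).symm (I.symm z) with hx
  have hxt : x ∈ (hq.localInverseAt a).target := h2
  set x' := hq.localInverseAt b (q x) with hx'
  have hqx : q x' = q x := hq.apply_localInverseAt_of_mem h3
  obtain ⟨φ, hφ, hφx, hφq⟩ := deck x x' hqx.symm
  have hx't : x' ∈ (hq.localInverseAt b).target := (hq.localInverseAt b).map_source h3
  have hzt : z ∈ (extChartAt I a).target := by
    rw [extChartAt_target]; exact ⟨h1, hzr⟩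
  have hsm : ContDiffWithinAt ℝ ∞ (extChartAt I b ∘ φ ∘ (extChartAt I a).symm) (Set.range I) z := by
    rw [← contMDiffWithinAt_iff_contDiffWithinAt]
    have e1 : ContMDiffWithinAt 𝓘(ℝ, E) I ∞ (extChartAt I a).symm (Set.range I) z :=
      contMDiffWithinAt_extChartAt_symm_range a hzt
    have e2 : ContMDiffAt I I ∞ φ ((extChartAt I a).symm z) := hφ _
    have e3 : ContMDiffAt I 𝓘(ℝ, E) ∞ (extChartAt I b) (φ ((extChartAt I a).symm z)) := by
      apply contMDiffAt_extChartAt'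
      change φ x ∈ _
      rw [hφx]; exact h4
    exact e3.comp_contMDiffWithinAt z (e2.comp_contMDiffWithinAt z e1)
  refine (hsm.congr_of_eventuallyEq_of_mem ?_ hzr).mono Set.inter_subset_right
  have hcont : ContinuousWithinAt (fun w => (chartAt H a).symm (I.symm w)) (Set.range I) z :=
    (((chartAt H a).continuousAt_symm h1).comp I.continuousAt_symm).continuousWithinAt
  have hev : ∀ᶠ w in 𝓝 x, q w ∈ (hq.localInverseAt b).source ∧
      φ w ∈ (hq.localInverseAt b).target := by
    refine Filter.Eventually.and ?_ ?_
    · exact hq.continuous.continuousAt.eventually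
        ((hq.localInverseAt b).open_source.mem_nhds h3)
    · refine hφ.continuous.continuousAt.eventually
        ((hq.localInverseAt b).open_target.mem_nhds ?_)
      rw [hφx]; exact hx't
  filter_upwards [hcont.eventually hev] with w hw
  have key : hq.localInverseAt b (q ((chartAt H a).symm (I.symm w))) =
      φ ((chartAt H a).symm (I.symm w)) := by
    apply hq.injOn_localInverseAt_target ((hq.localInverseAt b).map_source hw.1) hw.2
    rw [hq.apply_localInverseAt_of_mem hw.1, hφq]
  simp only [Function.comp_apply, OpenPartialHomeomorph.coe_trans,
    OpenPartialHomeomorph.trans_symm_eq_symm_trans_symm, IsLocalHomeomorph.localInverseAt_symm,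
    extChartAt_coe, extChartAt_coe_symm, key]

end QuotientManifold

/-! ### The 3-torus -/

/-- The 3-torus `Γ \ ℝ³` of a lattice `Γ`. -/
def Torus (Γ : Submodule ℤ (Fin 3 → ℝ)) : Type := (Fin 3 → ℝ) ⧸ Γ.toAddSubgroup

section Torus

variable (Γ : Submodule ℤ (Fin 3 → ℝ))

instance : TopologicalSpace (Torus Γ) :=
  inferInstanceAs (TopologicalSpace ((Fin 3 → ℝ) ⧸ Γ.toAddSubgroup))

/-- The projection `ℝ³ → Γ \ ℝ³`. -/
def Torus.mk (x : Fin 3 → ℝ) : Torus Γ := QuotientAddGroup.mk x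

theorem Torus.mk_surjective : Function.Surjective (Torus.mk Γ) :=
  QuotientAddGroup.mk_surjective

variable [DiscreteTopology Γ]

theorem Torus.isLocalHomeomorph_mk : IsLocalHomeomorph (Torus.mk Γ) :=
  (AddSubgroup.isAddQuotientCoveringMap_of_comm Γ.toAddSubgroup
    ⟨inferInstanceAs (DiscreteTopology Γ)⟩).isCoveringMap.isLocalHomeomorph

instance : ChartedSpace (Fin 3 → ℝ) (Torus Γ) :=
  (Torus.isLocalHomeomorph_mk Γ).chartedSpace (Torus.mk_surjective Γ)

instance : IsManifold 𝓘(ℝ, Fin 3 → ℝ) ∞ (Torus Γ) := by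
  refine isManifold_of_deck (Torus.isLocalHomeomorph_mk Γ) (Torus.mk_surjective Γ) ?_
  intro a b hab
  have hmem : -a + b ∈ Γ.toAddSubgroup := QuotientAddGroup.eq.1 hab
  refine ⟨fun z => z + (-a + b), ?_, by simp, fun z => ?_⟩
  · exact (contDiff_id.add contDiff_const).contMDiff
  · exact (QuotientAddGroup.eq.2 (by simpa using hmem)).symm

/-- The coordinate 1-forms `dx^i` on the torus, induced by the coordinates of `ℝ³`. -/
def dx (i : Fin 3) (x : Torus Γ) : TangentSpace 𝓘(ℝ, Fin 3 → ℝ) x →L[ℝ] ℝ :=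
  (ContinuousLinearMap.proj i : (Fin 3 → ℝ) →L[ℝ] ℝ) ∘L
    (mfderiv 𝓘(ℝ, Fin 3 → ℝ) 𝓘(ℝ, Fin 3 → ℝ) (extChartAt 𝓘(ℝ, Fin 3 → ℝ) x) x :
      TangentSpace 𝓘(ℝ, Fin 3 → ℝ) x →L[ℝ] (Fin 3 → ℝ))

end Torus

/-- The components, in the coordinate fields `∂/∂x^i`, of the vector fields
`e₁ = a₁ ∂₁`, `e₂ = b₂ ∂₂ + b₃ ∂₃`, `e₃ = -b₃ ∂₂ + b₂ ∂₃` at time `t`. -/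
def frame (a₁ b₂ b₃ : ℝ → ℝ) (t : ℝ) : Fin 3 → Fin 3 → ℝ :=
  ![![a₁ t, 0, 0], ![0, b₂ t, b₃ t], ![0, -b₃ t, b₂ t]]

/-- `l = b₂² + b₃²`. -/
def ell (b₂ b₃ : ℝ → ℝ) (t : ℝ) : ℝ := b₂ t ^ 2 + b₃ t ^ 2

/-- The dual 1-forms `e¹ = dx¹ / a₁`, `e² = (b₂ dx² + b₃ dx³) / l`,
`e³ = (-b₃ dx² + b₂ dx³) / l` on the torus, at time `t`. -/
def coframe (Γ : Submodule ℤ (Fin 3 → ℝ)) [DiscreteTopology Γ] (a₁ b₂ b₃ : ℝ → ℝ) (t : ℝ)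
    (i : Fin 3) (x : Torus Γ) : TangentSpace 𝓘(ℝ, Fin 3 → ℝ) x →L[ℝ] ℝ :=
  ![(1 / a₁ t) • dx Γ 0 x,
    (b₂ t / ell b₂ b₃ t) • dx Γ 1 x + (b₃ t / ell b₂ b₃ t) • dx Γ 2 x,
    (-(b₃ t / ell b₂ b₃ t)) • dx Γ 1 x + (b₂ t / ell b₂ b₃ t) • dx Γ 2 x] i

/-- Derivative of a function of `t ∈ [0, 1]` (one-sided at the end points). -/
def dot (h : ℝ → ℝ) (t : ℝ) : ℝ := derivWithin h (Set.Icc 0 1) t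

/-- `v = b₂ b₂' + b₃ b₃'`. -/
def vfun (b₂ b₃ : ℝ → ℝ) (t : ℝ) : ℝ := b₂ t * dot b₂ t + b₃ t * dot b₃ t

/-- `w = b₂ b₃' - b₃ b₂'`. -/
def wfun (b₂ b₃ : ℝ → ℝ) (t : ℝ) : ℝ := b₂ t * dot b₃ t - b₃ t * dot b₂ t

/-! ### Mapping tori -/

section MappingTorus

variable {E : Type*} [NormedAddCommGroup E] [NormedSpace ℝ E]
  {H : Type*} [TopologicalSpace H] {I : ModelWithCorners ℝ E H}
  {X : Type*} [TopologicalSpace X] [ChartedSpace H X]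

/-- The orbit relation of the action `n • (x, t) = (fⁿ x, t + n)` of `ℤ` on `X × ℝ`. -/
def mappingTorusSetoid (f : X ≃ₘ^∞⟮I, I⟯ X) : Setoid (X × ℝ) where
  r p p' := ∃ n : ℤ, ((f.toEquiv : Equiv.Perm X) ^ n) p.1 = p'.1 ∧ p.2 + n = p'.2
  iseqv := by
    refine ⟨fun p => ⟨0, by simp⟩, ?_, ?_⟩
    · rintro p p' ⟨n, h1, h2⟩
      refine ⟨-n, ?_, ?_⟩
      · rw [← h1, zpow_neg]; simp
      · rw [← h2]; push_cast; ring
    · rintro p p' p'' ⟨n, h1, h2⟩ ⟨m, h3, h4⟩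
      refine ⟨m + n, ?_, ?_⟩
      · rw [zpow_add, Equiv.Perm.mul_apply, h1, h3]
      · rw [← h4, ← h2]; push_cast; ring

/-- The mapping torus `X_f = (X × ℝ) / ℤ`, where `n • (x, t) = (fⁿ x, t + n)`. Since each orbit
meets `X × [0, 1)` exactly once, this is `X × [0, 1]` with `(x, 0)` glued to `(f x, 1)`. -/
def MappingTorus (f : X ≃ₘ^∞⟮I, I⟯ X) : Type _ := Quotient (mappingTorusSetoid f)

variable (f : X ≃ₘ^∞⟮I, I⟯ X)

instance : TopologicalSpace (MappingTorus f) :=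
  inferInstanceAs (TopologicalSpace (Quotient (mappingTorusSetoid f)))

/-- The class `[(x, t)]`. -/
def MappingTorus.mk (p : X × ℝ) : MappingTorus f := Quotient.mk (mappingTorusSetoid f) p

theorem MappingTorus.mk_surjective : Function.Surjective (MappingTorus.mk f) :=
  Quotient.mk_surjective

theorem MappingTorus.mk_eq_iff {p p' : X × ℝ} : MappingTorus.mk f p = MappingTorus.mk f p' ↔
    ∃ n : ℤ, ((f.toEquiv : Equiv.Perm X) ^ n) p.1 = p'.1 ∧ p.2 + n = p'.2 :=
  Quotient.eq

/-- The action of `n : ℤ` on `X × ℝ`. -/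
def mappingTorusDeck (n : ℤ) (p : X × ℝ) : X × ℝ :=
  (((f.toEquiv : Equiv.Perm X) ^ n) p.1, p.2 + n)

theorem contMDiff_zpow (n : ℤ) : ContMDiff I I ∞ ((f.toEquiv : Equiv.Perm X) ^ n) := by
  have key : ∀ (g : X ≃ₘ^∞⟮I, I⟯ X) (m : ℕ), ContMDiff I I ∞ ((g.toEquiv : Equiv.Perm X) ^ m) := by
    intro g m
    induction m with
    | zero => exact contMDiff_id
    | succ m ih =>
      rw [pow_succ]
      exact ih.comp g.contMDiff
  cases n with
  | ofNat m => exact key f m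
  | negSucc m =>
    have h : (f.toEquiv : Equiv.Perm X) ^ (Int.negSucc m) =
        (f.symm.toEquiv : Equiv.Perm X) ^ (m + 1) := by
      rw [zpow_negSucc, ← inv_pow]; rfl
    rw [h]
    exact key f.symm (m + 1)

theorem contMDiff_mappingTorusDeck (n : ℤ) :
    ContMDiff (I.prod 𝓘(ℝ, ℝ)) (I.prod 𝓘(ℝ, ℝ)) ∞ (mappingTorusDeck f n) :=
  ((contMDiff_zpow f n).comp contMDiff_fst).prodMk
    (((contDiff_id.add contDiff_const).contMDiff (f := fun t : ℝ => t + n)).comp contMDiff_snd)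

theorem MappingTorus.isLocalHomeomorph_mk : IsLocalHomeomorph (MappingTorus.mk f) := by
  have hcont : Continuous (MappingTorus.mk f) := continuous_quotient_mk'
  have hopen : IsOpenMap (MappingTorus.mk f) := by
    intro U hU
    have hpre : MappingTorus.mk f ⁻¹' (MappingTorus.mk f '' U) =
        ⋃ n : ℤ, (mappingTorusDeck f n) ⁻¹' U := by
      ext p
      simp only [Set.mem_preimage, Set.mem_image, Set.mem_iUnion]
      constructor
      · rintro ⟨p', hp', h⟩
        obtain ⟨n, h1, h2⟩ := (MappingTorus.mk_eq_iff f).1 h.symm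
        exact ⟨n, by rw [mappingTorusDeck, h1, h2]; exact hp'⟩
      · rintro ⟨n, hn⟩
        exact ⟨_, hn, ((MappingTorus.mk_eq_iff f).2 ⟨n, rfl, rfl⟩).symm⟩
    change IsOpen (MappingTorus.mk f ⁻¹' (MappingTorus.mk f '' U))
    rw [hpre]
    exact isOpen_iUnion fun n => hU.preimage (contMDiff_mappingTorusDeck f n).continuous
  rw [isLocalHomeomorph_iff_isOpenEmbedding_restrict]
  rintro ⟨x, t⟩
  have hV : IsOpen (Set.univ ×ˢ Set.Ioo (t - 1 / 2) (t + 1 / 2) : Set (X × ℝ)) :=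
    isOpen_univ.prod isOpen_Ioo
  refine ⟨_, hV.mem_nhds ⟨trivial, by constructor <;> simp⟩, ?_⟩
  refine Topology.IsOpenEmbedding.of_continuous_injective_isOpenMap
    (hcont.comp continuous_subtype_val) ?_ (hopen.domRestrict hV)
  rintro ⟨⟨x₁, t₁⟩, -, h1, h1'⟩ ⟨⟨x₂, t₂⟩, -, h2, h2'⟩
  intro h
  obtain ⟨n, hn, hn'⟩ := (MappingTorus.mk_eq_iff f (p := (x₁, t₁)) (p' := (x₂, t₂))).1 h
  simp only at hn hn' h1 h1' h2 h2'
  have hn0 : n = 0 := by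
    have l1 : (n : ℝ) < 1 := by linarith
    have l2 : (-1 : ℝ) < n := by linarith
    have l1' : n < 1 := by exact_mod_cast l1
    have l2' : -1 < n := by exact_mod_cast l2
    omega
  subst hn0
  simp only [zpow_zero, Equiv.Perm.coe_one, id_eq, Int.cast_zero, add_zero] at hn hn'
  subst hn hn'
  rfl

instance : ChartedSpace (ModelProd H ℝ) (MappingTorus f) :=
  (MappingTorus.isLocalHomeomorph_mk f).chartedSpace (MappingTorus.mk_surjective f)

instance [IsManifold I ∞ X] : IsManifold (I.prod 𝓘(ℝ, ℝ)) ∞ (MappingTorus f) := by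
  refine isManifold_of_deck (MappingTorus.isLocalHomeomorph_mk f) (MappingTorus.mk_surjective f) ?_
  intro a b hab
  obtain ⟨n, h1, h2⟩ := (MappingTorus.mk_eq_iff f).1 hab
  exact ⟨mappingTorusDeck f n, contMDiff_mappingTorusDeck f n, Prod.ext h1 h2,
    fun z => ((MappingTorus.mk_eq_iff f).2 ⟨n, rfl, rfl⟩).symm⟩

end MappingTorus

section Block

variable {E : Type*} [NormedAddCommGroup E] [NormedSpace ℝ E]
  {N : Type*} [TopologicalSpace N] [ChartedSpace E N]
  {Γ : Submodule ℤ (Fin 3 → ℝ)} [DiscreteTopology Γ]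

/-- The model of `(𝕋³ × N) × ℝ`, hence of the mapping tori of `𝕋³ × N`. -/
abbrev model (E : Type*) [NormedAddCommGroup E] [NormedSpace ℝ E] :
    ModelWithCorners ℝ (((Fin 3 → ℝ) × E) × ℝ) (ModelProd (ModelProd (Fin 3 → ℝ) E) ℝ) :=
  (𝓘(ℝ, Fin 3 → ℝ).prod 𝓘(ℝ, E)).prod 𝓘(ℝ, ℝ)

/-- The mapping torus `M_f` of `M = 𝕋³ × N` by `f(x, p) = (ρ x, ψ p)`. -/
abbrev BlockTorus (ρ : Torus Γ ≃ₘ^∞⟮𝓘(ℝ, Fin 3 → ℝ), 𝓘(ℝ, Fin 3 → ℝ)⟯ Torus Γ)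
    (ψ : N ≃ₘ^∞⟮𝓘(ℝ, E), 𝓘(ℝ, E)⟯ N) :=
  MappingTorus (ρ.prodCongr ψ)

variable (ρ : Torus Γ ≃ₘ^∞⟮𝓘(ℝ, Fin 3 → ℝ), 𝓘(ℝ, Fin 3 → ℝ)⟯ Torus Γ)
  (ψ : N ≃ₘ^∞⟮𝓘(ℝ, E), 𝓘(ℝ, E)⟯ N)

/-- The inclusion `p ↦ [(x, p, t)]` of the fibre `N` over `[(x, t)]`. -/
def fibre (x : Torus Γ) (t : ℝ) (p : N) : BlockTorus ρ ψ :=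
  MappingTorus.mk (ρ.prodCongr ψ) ((x, p), t)

/-- The differential of the inclusion of the fibre. -/
def dfibre (x : Torus Γ) (t : ℝ) (p : N) :
    TangentSpace 𝓘(ℝ, E) p →L[ℝ] TangentSpace (model E) (fibre ρ ψ x t p) :=
  mfderiv 𝓘(ℝ, E) (model E) (fibre ρ ψ x t) p

end Block

end GKTorus

end

open GKTorus

/-! Put `κ = l(1)/l(0) = exp c`. Since `(1/l)' = -2v/l²`, the constant of the hypothesis is `-2
(v/l) / (a₁ l)`; it is nonzero and `v/l` takes the same value at 0 and 1, so `a₁ l` does too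
(`a_mul_ell_eq`). The relations `ρ^* e^i(1) = e^i(0)` then force the differential of `ρ`, in the
flat coordinates numbered 0, 1, 2, to multiply `x₀` by `κ⁻¹` and `x₁ + i x₂` by a complex number of
square modulus `κ` (`isTwistedSimilarity_of_coframe`).

From here on only `c` matters, and the structure is written with exponentials. On `𝕋³ × N × ℝ` take
`g = e^{2ct} dx₀² + e^{-ct} (dx₁² + dx₂²) + dt² + k`, with `I_±` sending `∂₀` to `± e^{ct} ∂ₜ` and
`∂₁` to `∂₂`, and equal to `J₁`, respectively `J₂`, on `N`. Replacing `t` by `t + 1` multiplies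
`e^{ct}` by `κ`, which the differential of `ρ` compensates, while `ψ` preserves `k` and the `J_i`;
so everything descends to the mapping torus. Each `I_±` is a product of complex structures in the
`(x₀, t)`, `(x₁, x₂)` and `N` directions, hence integrable. The fundamental forms are `± e^{ct} dx₀
∧ dt + e^{-ct} dx₁ ∧ dx₂ + Ω`, with `Ω = Ω₁` or `Ω₂` closed, so `dω_± = -c e^{-ct} dt ∧ dx₁ ∧ dx₂`
and `d^c ω_± = ± c dx₀ ∧ dx₁ ∧ dx₂`: opposite closed forms. The commutator vanishes off `N` and is
`2 J₃` on `N`, which gives non-splitness and the Poisson tensor.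

The tangent space of the quotient at `m` is the model space, read in a chart based at one chosen
representative `lift m`. The tensors are therefore defined pointwise, by block formulas at that
representative. The choice need not vary continuously, but two choices differ by a deck
transformation, so invariance gives a smooth expression in every chart (`chartEnd_torusEnd`,
`chartBilin_torusBilin`, `chartForm_torusForm`). All remaining assertions become computations on
`(ℝ³ × E) × ℝ`. -/

noncomputable section

namespace GKTorus

/-! ### Differentials of a quotient map in transported charts -/

section PushedCharts

variable {E : Type*} [NormedAddCommGroup E] [NormedSpace ℝ E]
  {H : Type*} [TopologicalSpace H] {I : ModelWithCorners ℝ E H}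
  {X : Type*} [TopologicalSpace X] [ChartedSpace H X]
  {Y : Type*} [TopologicalSpace Y] [ChartedSpace H Y] {q : X → Y}

/-- The charts of `Y` are those of `X`, transported by the local homeomorphism `q` at the points
selected by the section `c`. -/
structure PushedCharts (hq : IsLocalHomeomorph q) (c : Y → X) : Prop where
  section_eq : ∀ y, q (c y) = y
  chart_eq : ∀ y, chartAt H y = (hq.localInverseAt (c y)).trans (chartAt H (c y))

theorem pushedCharts_chartedSpace {Y' : Type*} [TopologicalSpace Y'] {q : X → Y'}
    (hq : IsLocalHomeomorph q) (hs : Function.Surjective q) :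
    @PushedCharts H _ X _ _ Y' _ (hq.chartedSpace hs) q hq hs.hasRightInverse.choose :=
  let _ := hq.chartedSpace (H := H) hs
  ⟨hs.hasRightInverse.choose_spec, fun _ => rfl⟩

namespace PushedCharts

variable {hq : IsLocalHomeomorph q} {c : Y → X} (h : PushedCharts (H := H) hq c)
include h

theorem extChartAt_eq (y : Y) (y' : Y) :
    extChartAt I y y' = extChartAt I (c y) (hq.localInverseAt (c y) y') := by
  simp only [extChartAt_coe, h.chart_eq y, Function.comp_apply, OpenPartialHomeomorph.coe_trans]

theorem extChartAt_symm_eq (y : Y) :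
    ((extChartAt I y).symm : E → Y) = q ∘ (extChartAt I (c y)).symm := by
  ext w
  simp only [extChartAt_coe_symm, h.chart_eq y, Function.comp_apply,
    OpenPartialHomeomorph.trans_symm_eq_symm_trans_symm, OpenPartialHomeomorph.coe_trans,
    IsLocalHomeomorph.localInverseAt_symm]

theorem extChartAt_target_subset (y : Y) :
    (extChartAt I y).target ⊆ (extChartAt I (c y)).target := by
  intro w hw
  rw [extChartAt_target] at hw ⊢
  refine ⟨?_, hw.2⟩
  have := hw.1
  simp only [h.chart_eq y] at this
  exact this.1

theorem extChartAt_self (y : Y) : extChartAt I y y = extChartAt I (c y) (c y) := by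
  rw [h.extChartAt_eq y]
  congr 1
  have := hq.localInverseAt_apply_self (x := c y)
  rwa [h.section_eq] at this

/-- The chart at `y` is the chart at `c y` after the local inverse of `q`, so `q` reads as the
identity map near `c y` in these two charts. -/
theorem hasMFDerivAt_section (y : Y) :
    HasMFDerivAt I I q (c y) (ContinuousLinearMap.id ℝ E) := by
  refine ⟨hq.continuous.continuousAt, ?_⟩
  have hev : ∀ᶠ w in 𝓝[Set.range I] (extChartAt I (c y) (c y)),
      writtenInExtChartAt I I (c y) q w = w := by
    have h1 : ∀ᶠ w in 𝓝 (extChartAt I (c y) (c y)),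
        (extChartAt I (c y)).symm w ∈ (hq.localInverseAt (c y)).target := by
      refine (continuousAt_extChartAt_symm (I := I) (c y)).eventually
        ((hq.localInverseAt (c y)).open_target.mem_nhds ?_)
      rw [extChartAt_to_inv]
      exact hq.self_mem_localInverseAt_target
    filter_upwards [h1.filter_mono nhdsWithin_le_nhds,
      extChartAt_target_mem_nhdsWithin (I := I) (c y)] with w hw hw'
    have h2 := (hq.localInverseAt (c y)).right_inv hw
    rw [IsLocalHomeomorph.localInverseAt_symm] at h2
    simp only [writtenInExtChartAt, h.section_eq, Function.comp_apply, h.extChartAt_eq, h2]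
    exact (extChartAt I (c y)).right_inv hw'
  refine ((hasFDerivWithinAt_id _ _).congr_of_eventuallyEq hev ?_)
  exact hev.self_of_nhdsWithin (Set.mem_range_self _)

/-- Since `q = q ∘ φ` and `q` has identity differential at the selected point `φ z`, the chain rule
leaves the differential of `φ`. -/
theorem hasMFDerivAt_of_deck {φ : X → X} {z : X} (hφ : MDifferentiableAt I I φ z)
    (hz : φ z = c (q z)) (hqφ : ∀ z, q (φ z) = q z) :
    HasMFDerivAt I I q z (mfderiv I I φ z : E →L[ℝ] E) := by
  have h1 := h.hasMFDerivAt_section (I := I) (q z)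
  rw [← hz] at h1
  have h2 := h1.comp z hφ.hasMFDerivAt
  have : q ∘ φ = q := funext hqφ
  rw [this] at h2
  exact h2

end PushedCharts

end PushedCharts

/-! ### Flat coordinates of the torus -/

section TorusDeriv

variable (Γ : Submodule ℤ (Fin 3 → ℝ)) [DiscreteTopology Γ]

/-- The point of `ℝ³` over `x` at which the chart of the torus at `x` is based. -/
def Torus.lift (x : Torus Γ) : Fin 3 → ℝ := (Torus.mk_surjective Γ).hasRightInverse.choose x

theorem Torus.pushedCharts :
    PushedCharts (H := Fin 3 → ℝ) (Torus.isLocalHomeomorph_mk Γ) (Torus.lift Γ) :=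
  pushedCharts_chartedSpace _ _

/-- Deck transformations are translations, whose differential is the identity; hence the choice of
representatives is invisible on tangent spaces. -/
theorem Torus.hasMFDerivAt_mk (y : Fin 3 → ℝ) :
    HasMFDerivAt 𝓘(ℝ, Fin 3 → ℝ) 𝓘(ℝ, Fin 3 → ℝ) (Torus.mk Γ) y
      (ContinuousLinearMap.id ℝ (Fin 3 → ℝ)) := by
  set d := -y + Torus.lift Γ (Torus.mk Γ y) with hd
  have hmem : d ∈ Γ.toAddSubgroup :=
    QuotientAddGroup.eq.1 ((Torus.pushedCharts Γ).section_eq (Torus.mk Γ y)).symm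
  have hφ : HasFDerivAt (fun z : Fin 3 → ℝ => z + d) (ContinuousLinearMap.id ℝ (Fin 3 → ℝ)) y :=
    (hasFDerivAt_id y).add_const d
  have key := (Torus.pushedCharts Γ).hasMFDerivAt_of_deck (I := 𝓘(ℝ, Fin 3 → ℝ))
    (φ := fun z => z + d) (z := y)
    hφ.hasMFDerivAt.mdifferentiableAt (by simp [hd]) (fun z => ?_)
  · rw [hφ.hasMFDerivAt.mfderiv] at key
    exact key
  · exact (QuotientAddGroup.eq.2 (by simpa using hmem)).symm

theorem Torus.hasMFDerivAt_extChartAt_symm (x : Torus Γ) (y : Fin 3 → ℝ) :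
    HasMFDerivAt 𝓘(ℝ, Fin 3 → ℝ) 𝓘(ℝ, Fin 3 → ℝ) (extChartAt 𝓘(ℝ, Fin 3 → ℝ) x).symm y
      (ContinuousLinearMap.id ℝ (Fin 3 → ℝ)) := by
  rw [(Torus.pushedCharts Γ).extChartAt_symm_eq]
  exact Torus.hasMFDerivAt_mk Γ y

theorem dx_apply (i : Fin 3) (x : Torus Γ) (v : Fin 3 → ℝ) : dx Γ i x v = v i := by
  have h : mfderiv 𝓘(ℝ, Fin 3 → ℝ) 𝓘(ℝ, Fin 3 → ℝ) (extChartAt 𝓘(ℝ, Fin 3 → ℝ) x) x =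
    ContinuousLinearMap.id ℝ _ := mfderiv_extChartAt_self
  unfold dx
  rw [h]
  rfl

end TorusDeriv

/-! ### Integer iterates of a diffeomorphism -/

section Iterates

variable {E : Type*} [NormedAddCommGroup E] [NormedSpace ℝ E]
  {H : Type*} [TopologicalSpace H] {I : ModelWithCorners ℝ E H}
  {X : Type*} [TopologicalSpace X] [ChartedSpace H X]

theorem zpow_induction (f : X ≃ₘ^∞⟮I, I⟯ X) (Q : ℤ → (X → X) → Prop) (h0 : Q 0 id)
    (hf : ∀ n φ, ContMDiff I I ∞ φ → Q n φ → Q (n + 1) (φ ∘ f))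
    (hf' : ∀ n φ, ContMDiff I I ∞ φ → Q n φ → Q (n - 1) (φ ∘ f.symm)) (n : ℤ) :
    Q n ⇑((f.toEquiv : Equiv.Perm X) ^ n) := by
  induction n using Int.induction_on with
  | zero => simpa using h0
  | succ n ih =>
    rw [zpow_add_one]
    exact hf _ ⇑((f.toEquiv : Equiv.Perm X) ^ (n : ℤ)) (contMDiff_zpow f _) ih
  | pred n ih =>
    rw [zpow_sub_one]
    exact hf' _ ⇑((f.toEquiv : Equiv.Perm X) ^ (-n : ℤ)) (contMDiff_zpow f _) ih

theorem mfderiv_symm_comp (f : X ≃ₘ^∞⟮I, I⟯ X) (x : X) :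
    (mfderiv I I f.symm (f x) : E →L[ℝ] E) ∘L (mfderiv I I f x : E →L[ℝ] E) =
      ContinuousLinearMap.id ℝ E := by
  have h1 := (f.symm.contMDiff.mdifferentiable (by simp) (f x)).hasMFDerivAt.comp x
    (f.contMDiff.mdifferentiable (by simp) x).hasMFDerivAt
  have h2 : (f.symm ∘ f : X → X) = id := funext f.symm_apply_apply
  rw [h2] at h1
  exact hasMFDerivAt_unique h1 (hasMFDerivAt_id x)

theorem mfderiv_comp_symm (f : X ≃ₘ^∞⟮I, I⟯ X) (x : X) :
    (mfderiv I I f (f.symm x) : E →L[ℝ] E) ∘L (mfderiv I I f.symm x : E →L[ℝ] E) =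
      ContinuousLinearMap.id ℝ E :=
  mfderiv_symm_comp f.symm x

end Iterates

/-! ### The differential of the gluing map of the torus -/

section Similarity

/-- `L` scales the first coordinate by `κ⁻¹` and is the multiplication by a complex number of square
modulus `κ` on the last two coordinates. -/
def IsTwistedSimilarity (κ : ℝ) (L : (Fin 3 → ℝ) →L[ℝ] (Fin 3 → ℝ)) : Prop :=
  ∃ β γ : ℝ, β ^ 2 + γ ^ 2 = κ ∧ ∀ v, L v 0 = κ⁻¹ * v 0 ∧ L v 1 = β * v 1 - γ * v 2 ∧
    L v 2 = γ * v 1 + β * v 2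

theorem IsTwistedSimilarity.id : IsTwistedSimilarity 1 (ContinuousLinearMap.id ℝ _) :=
  ⟨1, 0, by norm_num, fun v => by simp⟩

theorem IsTwistedSimilarity.comp {κ κ' : ℝ} {L L' : (Fin 3 → ℝ) →L[ℝ] (Fin 3 → ℝ)}
    (h : IsTwistedSimilarity κ L) (h' : IsTwistedSimilarity κ' L') :
    IsTwistedSimilarity (κ * κ') (L ∘L L') := by
  obtain ⟨β, γ, rfl, h⟩ := h
  obtain ⟨β', γ', rfl, h'⟩ := h'
  refine ⟨β * β' - γ * γ', γ * β' + β * γ', by ring, fun v => ?_⟩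
  obtain ⟨e0, e1, e2⟩ := h (L' v)
  obtain ⟨f0, f1, f2⟩ := h' v
  simp only [ContinuousLinearMap.comp_apply, e0, e1, e2, f0, f1, f2, mul_inv]
  refine ⟨by ring, by ring, by ring⟩

theorem IsTwistedSimilarity.of_comp_eq_id {κ : ℝ} (hκ : κ ≠ 0)
    {L L' : (Fin 3 → ℝ) →L[ℝ] (Fin 3 → ℝ)} (h : IsTwistedSimilarity κ L)
    (hL : L ∘L L' = ContinuousLinearMap.id ℝ _) : IsTwistedSimilarity κ⁻¹ L' := by
  obtain ⟨β, γ, hκ', h⟩ := h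
  -- The inverse of the complex number `β + iγ` is its conjugate divided by `κ`.
  refine ⟨β / κ, -γ / κ, by field_simp; linarith, fun v => ?_⟩
  obtain ⟨e0, e1, e2⟩ := h (L' v)
  have hv : L (L' v) = v := congrArg (fun T => T v) hL
  rw [hv] at e0 e1 e2
  refine ⟨?_, ?_, ?_⟩
  · rw [e0]; field_simp
  · rw [e1, e2]; field_simp; rw [← hκ']; ring
  · rw [e1, e2]; field_simp; rw [← hκ']; ring

variable {Γ : Submodule ℤ (Fin 3 → ℝ)} [DiscreteTopology Γ]

theorem isTwistedSimilarity_zpow (ρ : Torus Γ ≃ₘ^∞⟮𝓘(ℝ, Fin 3 → ℝ), 𝓘(ℝ, Fin 3 → ℝ)⟯ Torus Γ)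
    {κ : ℝ} (hκ : κ ≠ 0)
    (h : ∀ x, IsTwistedSimilarity κ (mfderiv 𝓘(ℝ, Fin 3 → ℝ) 𝓘(ℝ, Fin 3 → ℝ) ρ x)) (n : ℤ) :
    ∀ x, IsTwistedSimilarity (κ ^ n) (mfderiv 𝓘(ℝ, Fin 3 → ℝ) 𝓘(ℝ, Fin 3 → ℝ)
      ((ρ.toEquiv : Equiv.Perm (Torus Γ)) ^ n) x) := by
  refine zpow_induction ρ (fun n φ => ∀ x, IsTwistedSimilarity (κ ^ n)
    (mfderiv 𝓘(ℝ, Fin 3 → ℝ) 𝓘(ℝ, Fin 3 → ℝ) φ x)) ?_ ?_ ?_ n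
  · intro x
    rw [mfderiv_id, zpow_zero]
    exact IsTwistedSimilarity.id
  · intro n φ hφ ih x
    rw [mfderiv_comp x (hφ.mdifferentiable (by simp) _) (ρ.contMDiff.mdifferentiable (by simp) _),
      zpow_add_one₀ hκ]
    exact (ih (ρ x)).comp (h x)
  · intro n φ hφ ih x
    rw [mfderiv_comp x (hφ.mdifferentiable (by simp) _)
      (ρ.symm.contMDiff.mdifferentiable (by simp) _), zpow_sub_one₀ hκ]
    exact (ih (ρ.symm x)).comp ((h _).of_comp_eq_id hκ (mfderiv_comp_symm ρ x))

/-- With `ζ = x₁ + i x₂` and `z = b₂ + i b₃`, one has `e² + i e³ = dζ / z`; so preserving the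
coframe means multiplying `ζ` by `z(1)/z(0)`. The coordinate `x₀` is multiplied by `a₁(1)/a₁(0)`,
which `hal` identifies with `κ⁻¹`. -/
theorem isTwistedSimilarity_of_coframe {a₁ b₂ b₃ : ℝ → ℝ}
    (ha0 : a₁ 0 ≠ 0) (ha1 : a₁ 1 ≠ 0) (hl0 : ell b₂ b₃ 0 ≠ 0) (hl1 : ell b₂ b₃ 1 ≠ 0)
    (hal : a₁ 1 * ell b₂ b₃ 1 = a₁ 0 * ell b₂ b₃ 0)
    (ρ : Torus Γ ≃ₘ^∞⟮𝓘(ℝ, Fin 3 → ℝ), 𝓘(ℝ, Fin 3 → ℝ)⟯ Torus Γ)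
    (hρ : ∀ (i : Fin 3) (x : Torus Γ),
      coframe Γ a₁ b₂ b₃ 1 i (ρ x) ∘L mfderiv 𝓘(ℝ, Fin 3 → ℝ) 𝓘(ℝ, Fin 3 → ℝ) ρ x =
        coframe Γ a₁ b₂ b₃ 0 i x) (x : Torus Γ) :
    IsTwistedSimilarity (ell b₂ b₃ 1 / ell b₂ b₃ 0)
      (mfderiv 𝓘(ℝ, Fin 3 → ℝ) 𝓘(ℝ, Fin 3 → ℝ) ρ x) := by
  -- Real and imaginary parts of `z(1)/z(0) = z(1) z̄(0) / l(0)`.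
  refine ⟨(b₂ 1 * b₂ 0 + b₃ 1 * b₃ 0) / ell b₂ b₃ 0, (b₃ 1 * b₂ 0 - b₂ 1 * b₃ 0) / ell b₂ b₃ 0,
    ?_, fun v => ?_⟩
  · field_simp
    simp only [ell]
    ring
  · set D : (Fin 3 → ℝ) →L[ℝ] (Fin 3 → ℝ) := mfderiv 𝓘(ℝ, Fin 3 → ℝ) 𝓘(ℝ, Fin 3 → ℝ) ρ x with hD
    have e0 : (1 / a₁ 1) * dx Γ 0 (ρ x) (D v) = (1 / a₁ 0) * dx Γ 0 x v :=
      congrArg (fun T : (Fin 3 → ℝ) →L[ℝ] ℝ => T v) (hρ 0 x)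
    have e1 : (b₂ 1 / ell b₂ b₃ 1) * dx Γ 1 (ρ x) (D v) + (b₃ 1 / ell b₂ b₃ 1) * dx Γ 2 (ρ x) (D v)
        = (b₂ 0 / ell b₂ b₃ 0) * dx Γ 1 x v + (b₃ 0 / ell b₂ b₃ 0) * dx Γ 2 x v :=
      congrArg (fun T : (Fin 3 → ℝ) →L[ℝ] ℝ => T v) (hρ 1 x)
    have e2 : -(b₃ 1 / ell b₂ b₃ 1) * dx Γ 1 (ρ x) (D v) +
        (b₂ 1 / ell b₂ b₃ 1) * dx Γ 2 (ρ x) (D v)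
        = -(b₃ 0 / ell b₂ b₃ 0) * dx Γ 1 x v + (b₂ 0 / ell b₂ b₃ 0) * dx Γ 2 x v :=
      congrArg (fun T : (Fin 3 → ℝ) →L[ℝ] ℝ => T v) (hρ 2 x)
    rw [dx_apply, dx_apply] at e0
    rw [dx_apply, dx_apply, dx_apply, dx_apply] at e1 e2
    have hd1 : ell b₂ b₃ 1 = b₂ 1 ^ 2 + b₃ 1 ^ 2 := rfl
    refine ⟨?_, ?_, ?_⟩
    · have : D v 0 = a₁ 1 / a₁ 0 * v 0 := by
        field_simp at e0 ⊢
        linarith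
      rw [this, inv_div]
      congr 1
      field_simp
      exact hal
    -- A vector is the sum of the `e^i(v) e_i`; the brackets are the left-hand sides of `e1` and
    -- `e2`.
    · have : D v 1 = b₂ 1 * (b₂ 1 / ell b₂ b₃ 1 * D v 1 + b₃ 1 / ell b₂ b₃ 1 * D v 2) -
          b₃ 1 * (-(b₃ 1 / ell b₂ b₃ 1) * D v 1 + b₂ 1 / ell b₂ b₃ 1 * D v 2) := by
        field_simp
        rw [hd1]; ring
      rw [this, e1, e2]
      ring
    · have : D v 2 = b₃ 1 * (b₂ 1 / ell b₂ b₃ 1 * D v 1 + b₃ 1 / ell b₂ b₃ 1 * D v 2) +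
          b₂ 1 * (-(b₃ 1 / ell b₂ b₃ 1) * D v 1 + b₂ 1 / ell b₂ b₃ 1 * D v 2) := by
        field_simp
        rw [hd1]; ring
      rw [this, e1, e2]
      ring

/-- The constant equals `-2 (v/l) / (a₁ l)` at both ends of the interval, with the same `v/l`; being
nonzero, it determines `a₁ l`. -/
theorem a_mul_ell_eq {a₁ b₂ b₃ : ℝ → ℝ}
    (hb₂ : ContDiffOn ℝ ∞ b₂ (Set.Icc 0 1)) (hb₃ : ContDiffOn ℝ ∞ b₃ (Set.Icc 0 1))
    (hl : ∀ t ∈ Set.Icc (0 : ℝ) 1, ell b₂ b₃ t ≠ 0)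
    (hv : vfun b₂ b₃ 1 / ell b₂ b₃ 1 = vfun b₂ b₃ 0 / ell b₂ b₃ 0)
    (hconst : ∃ c : ℝ, c ≠ 0 ∧
      ∀ t ∈ Set.Icc (0 : ℝ) 1, dot (fun s => 1 / ell b₂ b₃ s) t * (1 / a₁ t) = c) :
    a₁ 1 * ell b₂ b₃ 1 = a₁ 0 * ell b₂ b₃ 0 := by
  obtain ⟨c, hc, h⟩ := hconst
  have hdot : ∀ t ∈ Set.Icc (0 : ℝ) 1, dot (fun s => 1 / ell b₂ b₃ s) t =
      -(2 * vfun b₂ b₃ t) / ell b₂ b₃ t ^ 2 := by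
    intro t ht
    have hu : UniqueDiffWithinAt ℝ (Set.Icc (0 : ℝ) 1) t := uniqueDiffOn_Icc zero_lt_one t ht
    have d2 := ((hb₂.differentiableOn (by simp)) t ht).hasDerivWithinAt
    have d3 := ((hb₃.differentiableOn (by simp)) t ht).hasDerivWithinAt
    have dl : HasDerivWithinAt (ell b₂ b₃) (2 * vfun b₂ b₃ t) (Set.Icc 0 1) t := by
      refine ((d2.pow 2).add (d3.pow 2)).congr_deriv ?_
      simp only [vfun, dot]
      push_cast
      ring
    have := dl.inv (hl t ht)
    unfold dot
    simp only [one_div]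
    exact this.derivWithin hu
  have m0 : (0 : ℝ) ∈ Set.Icc (0 : ℝ) 1 := by simp
  have m1 : (1 : ℝ) ∈ Set.Icc (0 : ℝ) 1 := by simp
  have h0 := h 0 m0
  have h1 := h 1 m1
  rw [hdot 0 m0] at h0
  rw [hdot 1 m1] at h1
  set q := vfun b₂ b₃ 0 / ell b₂ b₃ 0 with hq
  have k0 : -2 * q / (a₁ 0 * ell b₂ b₃ 0) = c := by
    rw [← h0, hq]; have := hl 0 m0; field_simp
  have k1 : -2 * q / (a₁ 1 * ell b₂ b₃ 1) = c := by
    rw [← h1, ← hv]; have := hl 1 m1; field_simp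
  -- Division by zero gives zero, so a vanishing denominator would contradict `c ≠ 0`.
  have n0 : a₁ 0 * ell b₂ b₃ 0 ≠ 0 := by
    intro h; rw [h, div_zero] at k0; exact hc k0.symm
  have n1 : a₁ 1 * ell b₂ b₃ 1 ≠ 0 := by
    intro h; rw [h, div_zero] at k1; exact hc k1.symm
  rw [div_eq_iff n0] at k0
  rw [div_eq_iff n1] at k1
  exact mul_left_cancel₀ hc (k1.symm.trans k0)

theorem frame_nondegenerate {a₁ b₂ b₃ : ℝ → ℝ} {t : ℝ}
    (h : LinearIndependent ℝ (frame a₁ b₂ b₃ t)) : a₁ t ≠ 0 ∧ 0 < ell b₂ b₃ t := by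
  have h0 := h.ne_zero 0
  have h1 := h.ne_zero 1
  constructor
  · intro h'
    apply h0
    ext i
    fin_cases i <;> simp [frame, h']
  · by_contra! h'
    simp only [ell] at h'
    apply h1
    have e2 : b₂ t = 0 := by nlinarith [sq_nonneg (b₂ t), sq_nonneg (b₃ t)]
    have e3 : b₃ t = 0 := by nlinarith [sq_nonneg (b₂ t), sq_nonneg (b₃ t)]
    ext i
    fin_cases i <;> simp [frame, e2, e3]

end Similarity

/-! ### Smoothness and exterior derivative in charts -/

section ChartCriteria

variable {E : Type*} [NormedAddCommGroup E] [NormedSpace ℝ E]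
  {H : Type*} [TopologicalSpace H] {I : ModelWithCorners ℝ E H} [I.Boundaryless]
  {M : Type*} [TopologicalSpace M] [ChartedSpace H M]

/-- The differential of the inverse of the chart at `x₀`. -/
def chartDeriv (I : ModelWithCorners ℝ E H) (x₀ : M) (u : E) : E →L[ℝ] E :=
  mfderiv 𝓘(ℝ, E) I (extChartAt I x₀).symm u

/-- The differential of the chart at `x₀`, at the point of coordinates `u`. -/
def chartDerivInv (I : ModelWithCorners ℝ E H) (x₀ : M) (u : E) : E →L[ℝ] E :=
  mfderiv I 𝓘(ℝ, E) (extChartAt I x₀) ((extChartAt I x₀).symm u)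

/-- The endomorphism `J x` of the tangent space, seen on the model space. -/
def endAt (J : EndField I M) (x : M) : E →L[ℝ] E := J x

/-- The bilinear form `k x` on the tangent space, seen on the model space. -/
def bilinAt (k : ∀ x : M, TangentSpace I x →L[ℝ] TangentSpace I x →L[ℝ] ℝ) (x : M) :
    E →L[ℝ] E →L[ℝ] ℝ := k x

/-- The form `α x` on the tangent space, seen on the model space. -/
def formAt {n : ℕ} (α : DForm I M n) (x : M) : E [⋀^Fin n]→L[ℝ] ℝ := α x

/-- The matrix of a field of bilinear forms in the chart at `x₀`. -/
def chartBilin (k : ∀ x : M, TangentSpace I x →L[ℝ] TangentSpace I x →L[ℝ] ℝ) (x₀ : M) :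
    E → E →L[ℝ] E →L[ℝ] ℝ := fun u =>
  (bilinAt k ((extChartAt I x₀).symm u)).bilinearComp
    (chartDeriv I x₀ u) (chartDeriv I x₀ u)

omit [I.Boundaryless] in
theorem chartBilin_apply (k : ∀ x : M, TangentSpace I x →L[ℝ] TangentSpace I x →L[ℝ] ℝ) (x₀ : M)
    (u v w : E) : chartBilin k x₀ u v w =
      bilinAt k ((extChartAt I x₀).symm u) (chartDeriv I x₀ u v) (chartDeriv I x₀ u w) := rfl

omit [I.Boundaryless] in
theorem chartEnd_eq (J : EndField I M) (x₀ : M) (u : E) :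
    chartEnd J x₀ u = chartDerivInv I x₀ u ∘L
      endAt J ((extChartAt I x₀).symm u) ∘L chartDeriv I x₀ u := rfl

omit [I.Boundaryless] in
theorem chartForm_apply {n : ℕ} (α : DForm I M n) (x₀ : M) (u : E) (v : Fin n → E) :
    chartForm α x₀ u v =
      formAt α ((extChartAt I x₀).symm u) (fun i => chartDeriv I x₀ u (v i)) := rfl

omit [I.Boundaryless] in
theorem extD_eq {n : ℕ} [IsManifold I 1 M] (α : DForm I M n) (x : M) :
    (extD α x : E [⋀^Fin (n + 1)]→L[ℝ] ℝ) = extDeriv (chartForm α x) (extChartAt I x x) := by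
  have h : mfderiv I 𝓘(ℝ, E) (extChartAt I x) x = ContinuousLinearMap.id ℝ _ :=
    mfderiv_extChartAt_self
  unfold extD
  rw [h]
  rfl

variable [IsManifold I ∞ M]

theorem chartDerivInv_comp_chartDeriv {x₀ : M} {u : E} (hu : u ∈ (extChartAt I x₀).target) :
    chartDerivInv I x₀ u ∘L chartDeriv I x₀ u = ContinuousLinearMap.id ℝ E := by
  have : IsManifold I 1 M := IsManifold.of_le (n := ∞) (by simp)
  have h := mfderiv_extChartAt_comp_mfderivWithin_extChartAt_symm (I := I) hu
  rw [I.range_eq_univ, mfderivWithin_univ] at h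
  exact h

theorem chartDeriv_comp_chartDerivInv {x₀ : M} {u : E} (hu : u ∈ (extChartAt I x₀).target) :
    chartDeriv I x₀ u ∘L chartDerivInv I x₀ u = ContinuousLinearMap.id ℝ E := by
  have : IsManifold I 1 M := IsManifold.of_le (n := ∞) (by simp)
  have h := mfderivWithin_extChartAt_symm_comp_mfderiv_extChartAt (I := I) hu
  rw [I.range_eq_univ, mfderivWithin_univ] at h
  exact h

/-- Smooth sections are defined through bundle trivializations; this identification lets them be
read through differentials of charts. -/
theorem symmL_eq_chartDeriv {x₀ : M} {u : E} (hu : u ∈ (extChartAt I x₀).target) :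
    ((trivializationAt E (TangentSpace I) x₀).symmL ℝ ((extChartAt I x₀).symm u) : E →L[ℝ] E) =
      chartDeriv I x₀ u := by
  have : IsManifold I 1 M := IsManifold.of_le (n := ∞) (by simp)
  have hx : (extChartAt I x₀).symm u ∈ (chartAt H x₀).source := by
    rw [← extChartAt_source (I := I)]
    exact (extChartAt I x₀).map_target hu
  have h := TangentBundle.symmL_trivializationAt (I := I) hx
  rw [I.range_eq_univ, mfderivWithin_univ] at h
  have key : ∀ y, y = u → (mfderiv 𝓘(ℝ, E) I (extChartAt I x₀).symm y : E →L[ℝ] E) =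
      chartDeriv I x₀ u := by
    rintro _ rfl; rfl
  exact h.trans (key _ ((extChartAt I x₀).right_inv hu))

theorem inCoordinates_eq_chartEnd (J : EndField I M) {x₀ : M} {u : E}
    (hu : u ∈ (extChartAt I x₀).target) :
    ContinuousLinearMap.inCoordinates E (fun x : M => TangentSpace I x) E
      (fun x : M => TangentSpace I x) x₀ ((extChartAt I x₀).symm u) x₀ ((extChartAt I x₀).symm u)
      (J ((extChartAt I x₀).symm u)) = chartEnd J x₀ u := by
  have : IsManifold I 1 M := IsManifold.of_le (n := ∞) (by simp)
  have hx : (extChartAt I x₀).symm u ∈ (chartAt H x₀).source := by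
    rw [← extChartAt_source (I := I)]
    exact (extChartAt I x₀).map_target hu
  have h1 := TangentBundle.continuousLinearMapAt_trivializationAt (I := I) hx
  have h2 := symmL_eq_chartDeriv hu
  rw [chartEnd_eq, ← h2]
  unfold ContinuousLinearMap.inCoordinates
  rw [h1]
  rfl

theorem inCoordinates_eq_chartBilin
    (k : ∀ x : M, TangentSpace I x →L[ℝ] TangentSpace I x →L[ℝ] ℝ) {x₀ : M} {u : E}
    (hu : u ∈ (extChartAt I x₀).target) :
    ContinuousLinearMap.inCoordinates E (fun x : M => TangentSpace I x) (E →L[ℝ] ℝ)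
      (fun x : M => TangentSpace I x →L[ℝ] ℝ) x₀ ((extChartAt I x₀).symm u)
      x₀ ((extChartAt I x₀).symm u)
      (k ((extChartAt I x₀).symm u)) = chartBilin k x₀ u := by
  have hx : (extChartAt I x₀).symm u ∈ (chartAt H x₀).source := by
    rw [← extChartAt_source (I := I)]
    exact (extChartAt I x₀).map_target hu
  have h2 := symmL_eq_chartDeriv hu
  ext v w
  rw [chartBilin_apply, ← h2]
  rw [inCoordinates_apply_eq₂ (E₃ := fun _ : M => ℝ) hx hx (by simp)]
  simp only [Bundle.Trivial.fiberBundle_trivializationAt', Bundle.Trivial.linearMapAt_trivialization]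
  have hs := fun v => (trivializationAt E (TangentSpace I) x₀).symmL_apply (R := ℝ) hx v
  exact congr (congrArg (fun a => ⇑(k ((extChartAt I x₀).symm u) a)) (hs v).symm) (hs w).symm

theorem contMDiffAt_iff_of_chart {F : Type*} [NormedAddCommGroup F] [NormedSpace ℝ F]
    {φ : M → F} {φ' : E → F} {x₀ : M}
    (h : ∀ u ∈ (extChartAt I x₀).target, φ ((extChartAt I x₀).symm u) = φ' u) :
    ContMDiffAt I 𝓘(ℝ, F) ∞ φ x₀ ↔ ContDiffAt ℝ ∞ φ' (extChartAt I x₀ x₀) := by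
  constructor
  · intro hφ
    rw [← contMDiffAt_iff_contDiffAt]
    have h1 : ContMDiffAt 𝓘(ℝ, E) I ∞ (extChartAt I x₀).symm (extChartAt I x₀ x₀) :=
      (contMDiffOn_extChartAt_symm x₀).contMDiffAt (extChartAt_target_mem_nhds x₀)
    have h2 : ContMDiffAt 𝓘(ℝ, E) 𝓘(ℝ, F) ∞ (φ ∘ (extChartAt I x₀).symm) (extChartAt I x₀ x₀) :=
      ContMDiffAt.comp _ (by rwa [extChartAt_to_inv]) h1
    refine h2.congr_of_eventuallyEq ?_
    filter_upwards [extChartAt_target_mem_nhds (I := I) x₀] with u hu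
    exact (h u hu).symm
  · intro hφ
    have h2 : ContMDiffAt I 𝓘(ℝ, F) ∞ (φ' ∘ extChartAt I x₀) x₀ :=
      ContMDiffAt.comp _ hφ.contMDiffAt (contMDiffAt_extChartAt (I := I))
    refine h2.congr_of_eventuallyEq ?_
    filter_upwards [extChartAt_source_mem_nhds (I := I) x₀] with x hx
    have := h _ ((extChartAt I x₀).map_source hx)
    rwa [(extChartAt I x₀).left_inv hx] at this

/-- Every point is the centre of its own chart, so smoothness of the matrix at the centres suffices.
-/
theorem smoothEnd_iff (J : EndField I M) :
    SmoothEnd J ↔ ∀ x₀, ContDiffAt ℝ ∞ (chartEnd J x₀) (extChartAt I x₀ x₀) := by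
  unfold SmoothEnd
  refine forall_congr' fun x₀ => ?_
  rw [contMDiffAt_hom_bundle]
  refine (and_iff_right contMDiffAt_id).trans ?_
  exact contMDiffAt_iff_of_chart fun u hu => inCoordinates_eq_chartEnd J hu

theorem contMDiff_bilin_iff (k : ∀ x : M, TangentSpace I x →L[ℝ] TangentSpace I x →L[ℝ] ℝ) :
    ContMDiff I (I.prod 𝓘(ℝ, E →L[ℝ] E →L[ℝ] ℝ)) ∞ (fun x => Bundle.TotalSpace.mk'
      (E →L[ℝ] E →L[ℝ] ℝ)
      (E := fun x : M => TangentSpace I x →L[ℝ] TangentSpace I x →L[ℝ] ℝ) x (k x)) ↔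
      ∀ x₀, ContDiffAt ℝ ∞ (chartBilin k x₀) (extChartAt I x₀ x₀) := by
  refine forall_congr' fun x₀ => ?_
  rw [contMDiffAt_hom_bundle]
  refine (and_iff_right contMDiffAt_id).trans ?_
  exact contMDiffAt_iff_of_chart fun u hu => inCoordinates_eq_chartBilin k hu

end ChartCriteria

/-! ### The Nijenhuis tensor on a vector space -/

section Nijenhuis

variable {E : Type*} [NormedAddCommGroup E] [NormedSpace ℝ E]

/-- The Nijenhuis tensor of a field of endomorphisms of a vector space. -/
def nijenhuisAt (A : E → E →L[ℝ] E) (p u v : E) : E :=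
  fderiv ℝ (fun y => A y v) p (A p u) - fderiv ℝ (fun y => A y u) p (A p v) -
    A p (fderiv ℝ (fun y => A y v) p u - fderiv ℝ (fun y => A y u) p v)

theorem nijenhuis_eq {H : Type*} [TopologicalSpace H] {I : ModelWithCorners ℝ E H}
    {M : Type*} [TopologicalSpace M] [ChartedSpace H M] (J : EndField I M) (x : M) (u v : E) :
    nijenhuis J x u v = nijenhuisAt (chartEnd J x) (extChartAt I x x) u v := by
  simp only [nijenhuis, nijenhuisAt, VectorField.lieBracket, fderiv_fun_const, Pi.zero_apply,
    zero_apply, zero_sub, sub_zero]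
  congr 2
  abel

theorem nijenhuisAt_congr {A B : E → E →L[ℝ] E} {p : E} (h : A =ᶠ[𝓝 p] B) (u v : E) :
    nijenhuisAt A p u v = nijenhuisAt B p u v := by
  have h' : ∀ v, fderiv ℝ (fun y => A y v) p = fderiv ℝ (fun y => B y v) p := fun v =>
    Filter.EventuallyEq.fderiv_eq (h.fun_comp fun T => T v)
  simp only [nijenhuisAt, h', h.self_of_nhds]

end Nijenhuis

/-! ### Exterior products and alternation -/

section Wedge

variable {V : Type*} [NormedAddCommGroup V] [NormedSpace ℝ V]

/-- The exterior product of a linear form and an alternating form. -/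
def wedge {n : ℕ} (α : V →L[ℝ] ℝ) (η : V [⋀^Fin n]→L[ℝ] ℝ) : V [⋀^Fin (n + 1)]→L[ℝ] ℝ :=
  ContinuousAlternatingMap.alternatizeUncurryFin (α.smulRight η)

/-- The exterior product of two linear forms. -/
def wedge₂ (α β : V →L[ℝ] ℝ) : V [⋀^Fin 2]→L[ℝ] ℝ :=
  wedge α (ContinuousAlternatingMap.ofSubsingleton ℝ V ℝ (0 : Fin 1) β)

theorem wedge₂_apply (α β : V →L[ℝ] ℝ) (v : Fin 2 → V) :
    wedge₂ α β v = α (v 0) * β (v 1) - α (v 1) * β (v 0) := by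
  simp [wedge₂, wedge, ContinuousAlternatingMap.alternatizeUncurryFin_apply, Fin.sum_univ_two,
    Fin.removeNth, sub_eq_add_neg]

theorem wedge_wedge₂_apply (α β γ : V →L[ℝ] ℝ) (v : Fin 3 → V) :
    wedge α (wedge₂ β γ) v = α (v 0) * (β (v 1) * γ (v 2) - β (v 2) * γ (v 1)) -
      α (v 1) * (β (v 0) * γ (v 2) - β (v 2) * γ (v 0)) +
      α (v 2) * (β (v 0) * γ (v 1) - β (v 1) * γ (v 0)) := by
  simp [wedge, ContinuousAlternatingMap.alternatizeUncurryFin_apply, Fin.sum_univ_three,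
    wedge₂_apply, Fin.removeNth, Fin.succAbove, sub_eq_add_neg]

theorem extDeriv_smul_const {n : ℕ} {f : V → ℝ} {f' : V →L[ℝ] ℝ} {p : V}
    (hf : HasFDerivAt f f' p) (η : V [⋀^Fin n]→L[ℝ] ℝ) :
    extDeriv (fun w => f w • η) p = wedge f' η := by
  unfold extDeriv wedge
  rw [(hf.smul_const η).fderiv]

/-- The alternating form `(u, v) ↦ (B(u, v) - B(v, u)) / 2`, as a linear function of `B`. -/
def alternation : (V →L[ℝ] V →L[ℝ] ℝ) →L[ℝ] V [⋀^Fin 2]→L[ℝ] ℝ :=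
  (1 / 2 : ℝ) • (ContinuousAlternatingMap.alternatizeUncurryFinCLM ℝ V ℝ ∘L
    ContinuousLinearMap.compL ℝ V (V →L[ℝ] ℝ) (V [⋀^Fin 1]→L[ℝ] ℝ)
      ((ContinuousAlternatingMap.ofSubsingletonLIE (𝕜 := ℝ) (E := V) (F := ℝ) (0 : Fin 1)).toContinuousLinearEquiv :
        (V →L[ℝ] ℝ) →L[ℝ] V [⋀^Fin 1]→L[ℝ] ℝ))

theorem alternation_apply (B : V →L[ℝ] V →L[ℝ] ℝ) (v : Fin 2 → V) :
    alternation B v = (B (v 0) (v 1) - B (v 1) (v 0)) / 2 := by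
  simp [alternation, ContinuousAlternatingMap.alternatizeUncurryFin_apply, Fin.sum_univ_two,
    Fin.removeNth]
  ring

/-- Written this way, `η` depends on `B` through a continuous linear map, so regularity of `B`
passes to `η`. -/
theorem eq_alternation {η : V [⋀^Fin 2]→L[ℝ] ℝ} {B : V →L[ℝ] V →L[ℝ] ℝ}
    (h : ∀ u v, η ![u, v] = B u v) : η = alternation B := by
  ext v
  have hv : v = ![v 0, v 1] := by ext i; fin_cases i <;> rfl
  have hs : η ![v 1, v 0] = - η ![v 0, v 1] := by
    have := η.map_swap ![v 0, v 1] (i := 0) (j := 1) (by simp)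
    refine Eq.trans (congrArg η ?_) this
    ext i; fin_cases i <;> simp
  rw [alternation_apply, ← h, ← h, hs, ← hv]
  ring

end Wedge

/-! ### The block tensors at a point -/

section Block

variable {E : Type*} [NormedAddCommGroup E] [NormedSpace ℝ E]

/-- The model space of the mapping tori of `𝕋³ × N`. -/
abbrev BlockSpace (E : Type*) := ((Fin 3 → ℝ) × E) × ℝ

/-- The coordinate forms of the torus factor of `(ℝ³ × E) × ℝ`. -/
def tor (i : Fin 3) : BlockSpace E →L[ℝ] ℝ :=
  (ContinuousLinearMap.proj i : (Fin 3 → ℝ) →L[ℝ] ℝ) ∘L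
    ContinuousLinearMap.fst ℝ (Fin 3 → ℝ) E ∘L ContinuousLinearMap.fst ℝ ((Fin 3 → ℝ) × E) ℝ

/-- The last coordinate form of `(ℝ³ × E) × ℝ`. -/
def tim : BlockSpace E →L[ℝ] ℝ := ContinuousLinearMap.snd ℝ ((Fin 3 → ℝ) × E) ℝ

/-- The projection of `(ℝ³ × E) × ℝ` onto `E`. -/
def toE : BlockSpace E →L[ℝ] E :=
  ContinuousLinearMap.snd ℝ (Fin 3 → ℝ) E ∘L ContinuousLinearMap.fst ℝ ((Fin 3 → ℝ) × E) ℝ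

/-- The inclusion of `E` into `(ℝ³ × E) × ℝ`. -/
def ofE : E →L[ℝ] BlockSpace E :=
  ContinuousLinearMap.inl ℝ ((Fin 3 → ℝ) × E) ℝ ∘L ContinuousLinearMap.inr ℝ (Fin 3 → ℝ) E

@[simp] theorem tor_apply (i : Fin 3) (v : BlockSpace E) : tor i v = v.1.1 i := rfl

@[simp] theorem tim_apply (v : BlockSpace E) : tim v = v.2 := rfl

@[simp] theorem toE_apply (v : BlockSpace E) : toE v = v.1.2 := rfl

@[simp] theorem ofE_apply (v : E) : (ofE v : BlockSpace E) = ((0, v), 0) := rfl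

/-- The endomorphism of `(ℝ³ × E) × ℝ` equal to `A` on `E`, with `∂₀ ↦ σ a ∂ₜ`, `∂ₜ ↦ -σ b ∂₀` and
`∂₁ ↦ ∂₂ ↦ -∂₁`. -/
def blockEnd (σ a b : ℝ) (A : E →L[ℝ] E) :
    BlockSpace E →L[ℝ] BlockSpace E :=
  (tor 1).smulRight ((Pi.single 2 1, 0), 0) - (tor 2).smulRight ((Pi.single 1 1, 0), 0) +
    (σ * a) • (tor 0).smulRight ((0, 0), 1) - (σ * b) • tim.smulRight ((Pi.single 0 1, 0), 0) +
    ofE ∘L A ∘L toE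

theorem blockEnd_apply (σ a b : ℝ) (A : E →L[ℝ] E) (v : BlockSpace E) :
    blockEnd σ a b A v =
      ((![-(σ * b * v.2), -v.1.1 2, v.1.1 1], A v.1.2), σ * a * v.1.1 0) := by
  refine Prod.ext (Prod.ext ?_ ?_) ?_
  · ext i
    fin_cases i <;> simp [blockEnd]
  · simp [blockEnd]
  · simp [blockEnd]

theorem blockEnd_blockEnd {σ a b : ℝ} (hσ : σ * σ = 1) (hab : a * b = 1) {A : E →L[ℝ] E}
    (hA : ∀ v, A (A v) = -v) (v : BlockSpace E) :
    blockEnd σ a b A (blockEnd σ a b A v) = -v := by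
  rw [blockEnd_apply, blockEnd_apply]
  refine Prod.ext (Prod.ext ?_ ?_) ?_
  · ext i
    fin_cases i
    · change -(σ * b * (σ * a * v.1.1 0)) = -v.1.1 0
      linear_combination (-(a * b) * v.1.1 0) * hσ - v.1.1 0 * hab
    · simp
    · simp
  · simp [hA]
  · change σ * a * (-(σ * b * v.2)) = -v.2
    linear_combination (-(a * b) * v.2) * hσ - v.2 * hab

/-- The metric `a² dx₀² + b (dx₁² + dx₂²) + B + dt²` on `(ℝ³ × E) × ℝ`. -/
def blockBilin (a b : ℝ) (B : E →L[ℝ] E →L[ℝ] ℝ) :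
    BlockSpace E →L[ℝ] BlockSpace E →L[ℝ] ℝ :=
  (a ^ 2) • (tor (E := E) 0).smulRight (tor (E := E) 0) +
    b • ((tor (E := E) 1).smulRight (tor (E := E) 1) + (tor (E := E) 2).smulRight (tor (E := E) 2)) +
    ContinuousLinearMap.precomp ℝ toE ∘L B ∘L toE + (tim (E := E)).smulRight (tim (E := E))

set_option synthInstance.maxHeartbeats 200000 in
theorem blockBilin_apply (a b : ℝ) (B : E →L[ℝ] E →L[ℝ] ℝ) (u v : BlockSpace E) :
    blockBilin a b B u v = a ^ 2 * (u.1.1 0 * v.1.1 0) +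
      b * (u.1.1 1 * v.1.1 1 + u.1.1 2 * v.1.1 2) + B u.1.2 v.1.2 + u.2 * v.2 := by
  simp [blockBilin]
  ring

theorem blockBilin_blockEnd {σ a b : ℝ} (hσ : σ * σ = 1) (hab : a * b = 1) {A : E →L[ℝ] E}
    {B : E →L[ℝ] E →L[ℝ] ℝ} (hA : ∀ u v, B (A u) (A v) = B u v)
    (u v : BlockSpace E) :
    blockBilin a b B (blockEnd σ a b A u) (blockEnd σ a b A v) = blockBilin a b B u v := by
  simp only [blockBilin_apply, blockEnd_apply, hA, Matrix.cons_val]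
  linear_combination (a ^ 2 * b ^ 2 * u.2 * v.2 + a ^ 2 * u.1.1 0 * v.1.1 0) * hσ +
    (1 + a * b) * u.2 * v.2 * hab

/-- The form `η + σ a dx₀ ∧ dt + b dx₁ ∧ dx₂` on `(ℝ³ × E) × ℝ`. -/
def blockForm (σ a b : ℝ) (η : E [⋀^Fin 2]→L[ℝ] ℝ) :
    BlockSpace E [⋀^Fin 2]→L[ℝ] ℝ :=
  η.compContinuousLinearMap toE + (σ * a) • wedge₂ (tor 0) tim + b • wedge₂ (tor 1) (tor 2)

theorem blockForm_apply (σ a b : ℝ) (η : E [⋀^Fin 2]→L[ℝ] ℝ)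
    (v : Fin 2 → BlockSpace E) :
    blockForm σ a b η v = η (fun i => (v i).1.2) +
      σ * a * ((v 0).1.1 0 * (v 1).2 - (v 1).1.1 0 * (v 0).2) +
      b * ((v 0).1.1 1 * (v 1).1.1 2 - (v 1).1.1 1 * (v 0).1.1 2) := by
  simp [blockForm, wedge₂_apply]
  rfl

theorem blockForm_eq {σ a b : ℝ} (hab : a * b = 1) {A : E →L[ℝ] E} {B : E →L[ℝ] E →L[ℝ] ℝ}
    {η : E [⋀^Fin 2]→L[ℝ] ℝ} (h : ∀ u v, η ![u, v] = B (A u) v)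
    (u v : BlockSpace E) :
    blockForm σ a b η ![u, v] = blockBilin a b B (blockEnd σ a b A u) v := by
  have : (fun i => (![u, v] i).1.2) = ![u.1.2, v.1.2] := by ext i; fin_cases i <;> rfl
  simp only [blockForm_apply, blockBilin_apply, blockEnd_apply, Matrix.cons_val, this, h]
  linear_combination σ * a * v.1.1 0 * u.2 * hab

/-- The volume form `dx₀ ∧ dx₁ ∧ dx₂` of the torus factor. -/
def torVol : BlockSpace E [⋀^Fin 3]→L[ℝ] ℝ := wedge (tor 0) (wedge₂ (tor 1) (tor 2))

/-- Pullback by minus the block endomorphism turns `dt` into `-σ a dx₀` and fixes `dx₁ ∧ dx₂`, on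
which it is a rotation. -/
theorem wedge_tim_blockEnd (c σ : ℝ) {a b : ℝ} (hab : a * b = 1) (A : E →L[ℝ] E) :
    ((c * b) • wedge (tim (E := E)) (wedge₂ (tor 1) (tor 2))).compContinuousLinearMap
      (-blockEnd σ a b A) = (-(c * σ)) • torVol := by
  ext v
  simp [torVol, wedge_wedge₂_apply, blockEnd_apply]
  linear_combination (-c * σ * ((v 0).1.1 0 * ((v 1).1.1 1 * (v 2).1.1 2 - (v 2).1.1 1 * (v 1).1.1 2)
    - (v 1).1.1 0 * ((v 0).1.1 1 * (v 2).1.1 2 - (v 2).1.1 1 * (v 0).1.1 2)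
    + (v 2).1.1 0 * ((v 0).1.1 1 * (v 1).1.1 2 - (v 1).1.1 1 * (v 0).1.1 2))) * hab

end Block

/-! ### The block tensors as fields: regularity, Nijenhuis tensor, exterior derivative -/

section BlockFields

variable {E : Type*} [NormedAddCommGroup E] [NormedSpace ℝ E] (σ c : ℝ)

/-- The field `blockEnd` with time-dependent coefficients `exp (± c t)`. -/
def blockEndField (A : E → E →L[ℝ] E) (w : BlockSpace E) : BlockSpace E →L[ℝ] BlockSpace E :=
  blockEnd σ (Real.exp (c * w.2)) (Real.exp (-(c * w.2))) (A w.1.2)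

/-- The field `blockBilin` with time-dependent coefficients `exp (± c t)`. -/
def blockBilinField (B : E → E →L[ℝ] E →L[ℝ] ℝ) (w : BlockSpace E) :
    BlockSpace E →L[ℝ] BlockSpace E →L[ℝ] ℝ :=
  blockBilin (Real.exp (c * w.2)) (Real.exp (-(c * w.2))) (B w.1.2)

/-- The field `blockForm` with time-dependent coefficients `exp (± c t)`. -/
def blockFormField (η : E → E [⋀^Fin 2]→L[ℝ] ℝ) (w : BlockSpace E) :
    BlockSpace E [⋀^Fin 2]→L[ℝ] ℝ :=
  blockForm σ (Real.exp (c * w.2)) (Real.exp (-(c * w.2))) (η w.1.2)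

theorem hasFDerivAt_toE (p : BlockSpace E) : HasFDerivAt (fun w : BlockSpace E => w.1.2) toE p :=
  let h := (toE (E := E)).hasFDerivAt (x := p)
  h

theorem exp_mul_exp_neg (s : ℝ) : Real.exp (c * s) * Real.exp (-(c * s)) = 1 := by
  rw [← Real.exp_add, add_neg_cancel, Real.exp_zero]

theorem hasFDerivAt_exp_mul (p : BlockSpace E) :
    HasFDerivAt (fun w : BlockSpace E => Real.exp (c * w.2))
      ((c * Real.exp (c * p.2)) • tim) p := by
  have h := (tim (E := E)).hasFDerivAt (x := p)
  refine ((h.const_mul c).exp).congr_fderiv ?_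
  rw [smul_smul, mul_comm, tim_apply]

theorem hasFDerivAt_exp_neg_mul (p : BlockSpace E) :
    HasFDerivAt (fun w : BlockSpace E => Real.exp (-(c * w.2)))
      ((-c * Real.exp (-(c * p.2))) • tim) p := by
  simpa only [neg_mul] using hasFDerivAt_exp_mul (-c) p

theorem contDiffAt_blockEndField {A : E → E →L[ℝ] E} {p : BlockSpace E}
    (hA : ContDiffAt ℝ ∞ A p.1.2) : ContDiffAt ℝ ∞ (blockEndField σ c A) p := by
  have h1 : ContDiffAt ℝ ∞ (fun w : BlockSpace E => Real.exp (c * w.2)) p := by fun_prop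
  have h2 : ContDiffAt ℝ ∞ (fun w : BlockSpace E => Real.exp (-(c * w.2))) p := by fun_prop
  have h3 : ContDiffAt ℝ ∞ (fun w : BlockSpace E => A w.1.2) p :=
    ContDiffAt.comp p hA (by fun_prop)
  have h4 : ContDiffAt ℝ ∞ (fun w : BlockSpace E => (ofE ∘L A w.1.2 ∘L toE :
      BlockSpace E →L[ℝ] BlockSpace E)) p :=
    contDiffAt_const.clm_comp (h3.clm_comp contDiffAt_const)
  exact ((contDiffAt_const.add ((contDiffAt_const.mul h1).smul contDiffAt_const)).sub
    ((contDiffAt_const.mul h2).smul contDiffAt_const)).add h4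

set_option maxSynthPendingDepth 3 in
set_option synthInstance.maxHeartbeats 200000 in
theorem contDiffAt_blockBilinField {B : E → E →L[ℝ] E →L[ℝ] ℝ} {p : BlockSpace E}
    (hB : ContDiffAt ℝ ∞ B p.1.2) : ContDiffAt ℝ ∞ (blockBilinField c B) p := by
  have h1 : ContDiffAt ℝ ∞ (fun w : BlockSpace E => Real.exp (c * w.2)) p := by fun_prop
  have h2 : ContDiffAt ℝ ∞ (fun w : BlockSpace E => Real.exp (-(c * w.2))) p := by fun_prop
  have h3 : ContDiffAt ℝ ∞ (fun w : BlockSpace E => B w.1.2) p :=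
    ContDiffAt.comp p hB (by fun_prop)
  have h4 : ContDiffAt ℝ ∞ (fun w : BlockSpace E => (ContinuousLinearMap.precomp ℝ toE ∘L
      B w.1.2 ∘L toE : BlockSpace E →L[ℝ] BlockSpace E →L[ℝ] ℝ)) p :=
    contDiffAt_const.clm_comp (h3.clm_comp contDiffAt_const)
  exact ((((h1.pow 2).smul contDiffAt_const).add (h2.smul contDiffAt_const)).add h4).add
    contDiffAt_const

theorem fderiv_blockEndField {A : E → E →L[ℝ] E} {p : BlockSpace E}
    (hA : DifferentiableAt ℝ A p.1.2) (u v : BlockSpace E) :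
    fderiv ℝ (fun w => blockEndField σ c A w v) p u =
      ((![σ * c * Real.exp (-(c * p.2)) * u.2 * v.2, 0, 0],
        fderiv ℝ (fun y => A y v.1.2) p.1.2 u.1.2), σ * c * Real.exp (c * p.2) * u.2 * v.1.1 0) := by
  have hE : HasFDerivAt (fun w : BlockSpace E => A w.1.2 v.1.2)
      (fderiv ℝ (fun y => A y v.1.2) p.1.2 ∘L toE) p :=
    HasFDerivAt.comp (g := fun y => A y v.1.2) p
      (hA.clm_apply (differentiableAt_const v.1.2)).hasFDerivAt (hasFDerivAt_toE p)
  have h0 : HasFDerivAt (fun w : BlockSpace E => -(σ * Real.exp (-(c * w.2)) * v.2))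
      ((σ * c * Real.exp (-(c * p.2)) * v.2) • tim) p := by
    refine ((((hasFDerivAt_exp_neg_mul c p).const_mul σ).mul_const v.2).neg).congr_fderiv ?_
    ext <;> simp
    ring
  have ht : HasFDerivAt (fun w : BlockSpace E => σ * Real.exp (c * w.2) * v.1.1 0)
      ((σ * c * Real.exp (c * p.2) * v.1.1 0) • tim) p := by
    refine (((hasFDerivAt_exp_mul c p).const_mul σ).mul_const (v.1.1 0)).congr_fderiv ?_
    ext <;> simp
    ring
  have hT : HasFDerivAt (fun w : BlockSpace E =>
      (![-(σ * Real.exp (-(c * w.2)) * v.2), -v.1.1 2, v.1.1 1] : Fin 3 → ℝ))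
      (ContinuousLinearMap.pi ![(σ * c * Real.exp (-(c * p.2)) * v.2) • tim, 0, 0]) p := by
    rw [hasFDerivAt_pi]
    intro i
    fin_cases i
    · exact h0
    · exact hasFDerivAt_const _ _
    · exact hasFDerivAt_const _ _
  have h := (hT.prodMk hE).prodMk ht
  have heq : (fun w => blockEndField σ c A w v) = fun w : BlockSpace E =>
      (((![-(σ * Real.exp (-(c * w.2)) * v.2), -v.1.1 2, v.1.1 1] : Fin 3 → ℝ), A w.1.2 v.1.2),
        σ * Real.exp (c * w.2) * v.1.1 0) := funext fun w => blockEnd_apply _ _ _ _ _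
  rw [heq, h.fderiv]
  refine Prod.ext (Prod.ext ?_ rfl) ?_
  · ext i
    fin_cases i
    · change (σ * c * Real.exp (-(c * p.2)) * v.2) * u.2 = σ * c * Real.exp (-(c * p.2)) * u.2 * v.2
      ring
    · rfl
    · rfl
  · change (σ * c * Real.exp (c * p.2) * v.1.1 0) * u.2 = σ * c * Real.exp (c * p.2) * u.2 * v.1.1 0
    ring

/-- The field is a product: constant on the `(x₁, x₂)` plane, equal to `A` on `E`, and on the `(x₀,
t)` plane dependent on `t` alone, where the dimension two makes the tensor vanish. -/
theorem nijenhuisAt_blockEndField {A : E → E →L[ℝ] E} {p : BlockSpace E}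
    (hA : DifferentiableAt ℝ A p.1.2) (hN : ∀ u v, nijenhuisAt A p.1.2 u v = 0)
    (u v : BlockSpace E) : nijenhuisAt (blockEndField σ c A) p u v = 0 := by
  unfold nijenhuisAt
  simp only [fderiv_blockEndField σ c hA]
  simp only [blockEndField, blockEnd_apply]
  set a := Real.exp (c * p.2)
  set b := Real.exp (-(c * p.2))
  refine Prod.ext (Prod.ext ?_ ?_) ?_
  · ext i
    fin_cases i
    · simp
      ring
    · simp
    · simp
  · exact hN u.1.2 v.1.2
  · simp
    ring

/-- The term in `dx₀ ∧ dt` is closed because its coefficient depends on `t` only, and the term in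
`η` is the pullback of a form closed at the point; only `d(e^{-ct}) ∧ dx₁ ∧ dx₂` survives. -/
theorem extDeriv_blockFormField {η : E → E [⋀^Fin 2]→L[ℝ] ℝ} {p : BlockSpace E}
    (hη : DifferentiableAt ℝ η p.1.2) (hd : extDeriv η p.1.2 = 0) :
    extDeriv (blockFormField σ c η) p =
      (-c * Real.exp (-(c * p.2))) • wedge tim (wedge₂ (tor 1) (tor 2)) := by
  have d1 : DifferentiableAt ℝ
      (fun w : BlockSpace E => (η w.1.2).compContinuousLinearMap (toE (E := E))) p := by
    have h : DifferentiableAt ℝ (fun w : BlockSpace E => η w.1.2) p :=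
      hη.comp p (hasFDerivAt_toE p).differentiableAt
    exact ((ContinuousAlternatingMap.compContinuousLinearMapCLM (𝕜 := ℝ) (F := ℝ) (ι := Fin 2)
      (toE (E := E))).differentiableAt).comp p h
  have e1 : extDeriv (fun w : BlockSpace E =>
      (η w.1.2).compContinuousLinearMap (toE (E := E))) p = 0 := by
    have h := extDeriv_pullback (𝕜 := ℝ) (r := 2) (x := p) (f := toE (E := E)) hη
      (toE (E := E)).contDiff.contDiffAt (by simp)
    simp only [ContinuousLinearMap.fderiv] at h
    refine h.trans ?_
    change (extDeriv η p.1.2).compContinuousLinearMap _ = 0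
    rw [hd]
    rfl
  have h2 := (hasFDerivAt_exp_mul (E := E) c p).const_mul σ
  have h3 := hasFDerivAt_exp_neg_mul (E := E) c p
  have e2 := extDeriv_smul_const h2 (wedge₂ (tor 0) (tim (E := E)))
  have e3 := extDeriv_smul_const h3 (wedge₂ (tor (E := E) 1) (tor 2))
  have d2 := (h2.smul_const (wedge₂ (tor 0) (tim (E := E)))).differentiableAt
  have d3 := (h3.smul_const (wedge₂ (tor (E := E) 1) (tor 2))).differentiableAt
  have h := (extDeriv_fun_add (d1.add d2) d3).trans
    (congrArg₂ (· + ·) ((extDeriv_fun_add d1 d2).trans (congrArg₂ (· + ·) e1 e2)) e3)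
  refine Eq.trans h ?_
  ext v
  simp [wedge_wedge₂_apply]
  ring

end BlockFields

/-! ### Invariance of the block tensors under the linearized deck transformations -/

section BlockDeriv

variable {E : Type*} [NormedAddCommGroup E] [NormedSpace ℝ E]

/-- The endomorphism of `(ℝ³ × E) × ℝ` acting diagonally, by the identity on the last factor. -/
def blockDeriv (R : (Fin 3 → ℝ) →L[ℝ] (Fin 3 → ℝ)) (S : E →L[ℝ] E) :
    BlockSpace E →L[ℝ] BlockSpace E :=
  (R.prodMap S).prodMap (ContinuousLinearMap.id ℝ ℝ)

theorem blockDeriv_apply (R : (Fin 3 → ℝ) →L[ℝ] (Fin 3 → ℝ)) (S : E →L[ℝ] E) (v : BlockSpace E) :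
    blockDeriv R S v = ((R v.1.1, S v.1.2), v.2) := rfl

variable {κ : ℝ} {R : (Fin 3 → ℝ) →L[ℝ] (Fin 3 → ℝ)} {S : E →L[ℝ] E}

/-- On the `(x₁, x₂)` plane both maps are multiplications by complex numbers, so they commute. On
the `(x₀, t)` plane the factor `κ` gained by `a` undoes the scaling of `x₀` by `κ⁻¹`. -/
theorem blockEnd_blockDeriv (hκ : κ ≠ 0) (hR : IsTwistedSimilarity κ R) {A A' : E →L[ℝ] E}
    (hS : ∀ v, S (A v) = A' (S v)) (σ a b : ℝ) (v : BlockSpace E) :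
    blockEnd σ (a * κ) (b * κ⁻¹) A' (blockDeriv R S v) = blockDeriv R S (blockEnd σ a b A v) := by
  obtain ⟨β, γ, -, h⟩ := hR
  simp only [blockEnd_apply, blockDeriv_apply, hS]
  obtain ⟨e0, e1, e2⟩ := h v.1.1
  obtain ⟨f0, f1, f2⟩ := h ![-(σ * b * v.2), -v.1.1 2, v.1.1 1]
  refine Prod.ext (Prod.ext ?_ rfl) ?_
  · ext i
    fin_cases i
    · refine Eq.trans ?_ f0.symm
      simp
      ring
    · refine Eq.trans ?_ f1.symm
      simp [e2]
      ring
    · refine Eq.trans ?_ f2.symm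
      simp [e1]
      ring
  · simp only [e0]
    field_simp

/-- `R` multiplies `x₀²` by `κ⁻²` and `x₁² + x₂²` by `β² + γ² = κ`; the changes of `a²` and `b`
cancel these factors. -/
theorem blockBilin_blockDeriv (hκ : κ ≠ 0) (hR : IsTwistedSimilarity κ R)
    {B B' : E →L[ℝ] E →L[ℝ] ℝ} (hS : ∀ u v, B' (S u) (S v) = B u v) (a b : ℝ)
    (u v : BlockSpace E) :
    blockBilin (a * κ) (b * κ⁻¹) B' (blockDeriv R S u) (blockDeriv R S v) =
      blockBilin a b B u v := by
  obtain ⟨β, γ, hβ, h⟩ := hR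
  obtain ⟨e0, e1, e2⟩ := h u.1.1
  obtain ⟨f0, f1, f2⟩ := h v.1.1
  simp only [blockBilin_apply, blockDeriv_apply, hS, e0, e1, e2, f0, f1, f2]
  field_simp
  rw [← hβ]
  ring

theorem blockForm_blockDeriv (hκ : κ ≠ 0) (hR : IsTwistedSimilarity κ R)
    {η η' : E [⋀^Fin 2]→L[ℝ] ℝ} (hS : η'.compContinuousLinearMap S = η) (σ a b : ℝ) :
    (blockForm σ (a * κ) (b * κ⁻¹) η').compContinuousLinearMap (blockDeriv R S) =
      blockForm σ a b η := by
  obtain ⟨β, γ, hβ, h⟩ := hR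
  ext v
  obtain ⟨e0, e1, e2⟩ := h (v 0).1.1
  obtain ⟨f0, f1, f2⟩ := h (v 1).1.1
  rw [← hS, ContinuousAlternatingMap.compContinuousLinearMap_apply, blockForm_apply,
    blockForm_apply, ContinuousAlternatingMap.compContinuousLinearMap_apply]
  simp only [Function.comp_apply, blockDeriv_apply, e0, e1, e2, f0, f1, f2]
  rw [add_assoc, add_assoc]
  congr 1
  field_simp
  rw [← hβ]
  ring

/-- `R` has determinant `κ⁻¹ (β² + γ²) = 1`. -/
theorem torVol_blockDeriv (hκ : κ ≠ 0) (hR : IsTwistedSimilarity κ R) :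
    (torVol (E := E)).compContinuousLinearMap (blockDeriv R S) = torVol := by
  obtain ⟨β, γ, hβ, h⟩ := hR
  ext v
  obtain ⟨e0, e1, e2⟩ := h (v 0).1.1
  obtain ⟨f0, f1, f2⟩ := h (v 1).1.1
  obtain ⟨g0, g1, g2⟩ := h (v 2).1.1
  rw [ContinuousAlternatingMap.compContinuousLinearMap_apply]
  simp only [torVol, wedge_wedge₂_apply, Function.comp_apply, blockDeriv_apply, tor_apply,
    e0, e1, e2, f0, f1, f2, g0, g1, g2]
  field_simp
  rw [← hβ]
  ring

end BlockDeriv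

/-! ### Tensors on `N` preserved by the iterates of `ψ` -/

section Preserved

variable {E : Type*} [NormedAddCommGroup E] [NormedSpace ℝ E]
  {N : Type*} [TopologicalSpace N] [ChartedSpace E N]

/-- The differential of a map of `N` to itself, seen on the model space. -/
def derivAt (φ : N → N) (p : N) : E →L[ℝ] E := mfderiv 𝓘(ℝ, E) 𝓘(ℝ, E) φ p

/-- The differential of `φ` commutes with `J`. -/
def PreservesEnd (J : EndField 𝓘(ℝ, E) N) (φ : N → N) : Prop :=
  ∀ p v, derivAt (E := E) φ p (endAt J p v) = endAt J (φ p) (derivAt φ p v)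

/-- `φ` preserves the field of bilinear forms `k`. -/
def PreservesBilin
    (k : ∀ x : N, TangentSpace 𝓘(ℝ, E) x →L[ℝ] TangentSpace 𝓘(ℝ, E) x →L[ℝ] ℝ) (φ : N → N) : Prop :=
  ∀ p u v, bilinAt k (φ p) (derivAt (E := E) φ p u) (derivAt φ p v) = bilinAt k p u v

theorem derivAt_comp {φ χ : N → N} (hφ : ContMDiff 𝓘(ℝ, E) 𝓘(ℝ, E) ∞ φ)
    (hχ : ContMDiff 𝓘(ℝ, E) 𝓘(ℝ, E) ∞ χ) (p : N) (v : E) :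
    derivAt (φ ∘ χ) p v = derivAt φ (χ p) (derivAt χ p v) := by
  have h := mfderiv_comp p (hφ.mdifferentiable (by simp) (χ p)) (hχ.mdifferentiable (by simp) p)
  exact congrArg (fun T : E →L[ℝ] E => T v) h

theorem derivAt_id (p : N) (v : E) : derivAt id p v = v :=
  congrArg (fun T : E →L[ℝ] E => T v) (mfderiv_id (I := 𝓘(ℝ, E)) (x := p))

variable (ψ : N ≃ₘ^∞⟮𝓘(ℝ, E), 𝓘(ℝ, E)⟯ N)

theorem derivAt_derivAt_symm (p : N) (v : E) : derivAt ψ (ψ.symm p) (derivAt ψ.symm p v) = v :=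
  congrArg (fun T : E →L[ℝ] E => T v) (mfderiv_comp_symm ψ p)

theorem derivAt_symm_derivAt (p : N) (v : E) : derivAt ψ.symm (ψ p) (derivAt ψ p v) = v :=
  congrArg (fun T : E →L[ℝ] E => T v) (mfderiv_symm_comp ψ p)

theorem PreservesEnd.zpow {J : EndField 𝓘(ℝ, E) N} (h : PreservesEnd J ψ) (n : ℤ) :
    PreservesEnd J ⇑((ψ.toEquiv : Equiv.Perm N) ^ n) := by
  refine zpow_induction ψ (fun _ φ => PreservesEnd J φ) (fun p v => ?_) (fun _ φ hφ ih p v => ?_)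
    (fun _ φ hφ ih p v => ?_) n
  · simp only [derivAt_id, id_eq]
  · rw [derivAt_comp hφ ψ.contMDiff, derivAt_comp hφ ψ.contMDiff, h, ih]
    rfl
  · rw [derivAt_comp hφ ψ.symm.contMDiff, derivAt_comp hφ ψ.symm.contMDiff, Function.comp_apply,
      ← ih]
    congr 1
    have h1 := h (ψ.symm p) (derivAt ψ.symm p v)
    rw [derivAt_derivAt_symm, ψ.apply_symm_apply] at h1
    rw [← h1]
    have h2 := derivAt_symm_derivAt ψ (ψ.symm p) (endAt J (ψ.symm p) (derivAt ψ.symm p v))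
    rwa [ψ.apply_symm_apply] at h2

theorem PreservesBilin.zpow
    {k : ∀ x : N, TangentSpace 𝓘(ℝ, E) x →L[ℝ] TangentSpace 𝓘(ℝ, E) x →L[ℝ] ℝ}
    (h : PreservesBilin k ψ) (n : ℤ) : PreservesBilin k ⇑((ψ.toEquiv : Equiv.Perm N) ^ n) := by
  refine zpow_induction ψ (fun _ φ => PreservesBilin k φ) (fun p u v => ?_)
    (fun _ φ hφ ih p u v => ?_) (fun _ φ hφ ih p u v => ?_) n
  · simp only [derivAt_id, id_eq]
  · rw [derivAt_comp hφ ψ.contMDiff, derivAt_comp hφ ψ.contMDiff, Function.comp_apply, ih, h]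
  · rw [derivAt_comp hφ ψ.symm.contMDiff, derivAt_comp hφ ψ.symm.contMDiff, Function.comp_apply,
      ih, ← h, derivAt_derivAt_symm, derivAt_derivAt_symm, ψ.apply_symm_apply]

end Preserved

/-! ### The differential of the projection onto the mapping torus -/

section Lift

variable {E : Type*} [NormedAddCommGroup E] [NormedSpace ℝ E]
  {N : Type*} [TopologicalSpace N] [ChartedSpace E N]
  {Γ : Submodule ℤ (Fin 3 → ℝ)} [DiscreteTopology Γ]
  {ρ : Torus Γ ≃ₘ^∞⟮𝓘(ℝ, Fin 3 → ℝ), 𝓘(ℝ, Fin 3 → ℝ)⟯ Torus Γ}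
  {ψ : N ≃ₘ^∞⟮𝓘(ℝ, E), 𝓘(ℝ, E)⟯ N}

/-- The point over `m` at which the chart of the mapping torus at `m` is based. -/
def lift (m : BlockTorus ρ ψ) : (Torus Γ × N) × ℝ :=
  (MappingTorus.mk_surjective (ρ.prodCongr ψ)).hasRightInverse.choose m

/-- The component in `N` of `lift m`. -/
def base (m : BlockTorus ρ ψ) : N := (lift m).1.2

/-- The component in `ℝ` of `lift m`. -/
def time (m : BlockTorus ρ ψ) : ℝ := (lift m).2

theorem pushedCharts_lift : PushedCharts (H := ModelProd (ModelProd (Fin 3 → ℝ) E) ℝ)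
    (MappingTorus.isLocalHomeomorph_mk (ρ.prodCongr ψ)) (lift (ρ := ρ) (ψ := ψ)) :=
  pushedCharts_chartedSpace _ _

theorem prodCongr_zpow (n : ℤ) :
    ⇑(((ρ.prodCongr ψ).toEquiv : Equiv.Perm (Torus Γ × N)) ^ n) =
      Prod.map ⇑((ρ.toEquiv : Equiv.Perm (Torus Γ)) ^ n) ⇑((ψ.toEquiv : Equiv.Perm N) ^ n) := by
  have key : ((ρ.prodCongr ψ).toEquiv : Equiv.Perm (Torus Γ × N)) ^ n =
      Equiv.prodCongr ((ρ.toEquiv : Equiv.Perm (Torus Γ)) ^ n)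
        ((ψ.toEquiv : Equiv.Perm N) ^ n) := by
    induction n using Int.induction_on with
    | zero => rfl
    | succ n ih => rw [zpow_add_one, zpow_add_one, zpow_add_one, ih]; rfl
    | pred n ih => rw [zpow_sub_one, zpow_sub_one, zpow_sub_one, ih]; rfl
  rw [key]
  rfl

/-- The integer `n` carries `z` to the chosen representative of its orbit, and the differential is
that of the corresponding deck transformation. It depends on `z`, and no continuity is claimed. -/
theorem exists_hasMFDerivAt_mk {κ : ℝ} (hκ : κ ≠ 0)
    (hρ : ∀ x, IsTwistedSimilarity κ (mfderiv 𝓘(ℝ, Fin 3 → ℝ) 𝓘(ℝ, Fin 3 → ℝ) ρ x))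
    (z : (Torus Γ × N) × ℝ) :
    ∃ (n : ℤ) (R : (Fin 3 → ℝ) →L[ℝ] (Fin 3 → ℝ)), IsTwistedSimilarity (κ ^ n) R ∧
      base (MappingTorus.mk (ρ.prodCongr ψ) z) = ((ψ.toEquiv : Equiv.Perm N) ^ n) z.1.2 ∧
      time (MappingTorus.mk (ρ.prodCongr ψ) z) = z.2 + n ∧
      HasMFDerivAt (model E) (model E) (MappingTorus.mk (ρ.prodCongr ψ)) z
        (blockDeriv R (derivAt ⇑((ψ.toEquiv : Equiv.Perm N) ^ n) z.1.2)) := by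
  obtain ⟨n, h1, h2⟩ := (MappingTorus.mk_eq_iff (ρ.prodCongr ψ)).1
    ((pushedCharts_lift (ρ := ρ) (ψ := ψ)).section_eq (MappingTorus.mk (ρ.prodCongr ψ) z)).symm
  refine ⟨n, mfderiv 𝓘(ℝ, Fin 3 → ℝ) 𝓘(ℝ, Fin 3 → ℝ)
    ⇑((ρ.toEquiv : Equiv.Perm (Torus Γ)) ^ n) z.1.1, isTwistedSimilarity_zpow ρ hκ hρ n _, ?_,
    h2.symm, ?_⟩
  · rw [prodCongr_zpow] at h1
    exact (congrArg Prod.snd h1).symm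
  · have hd := contMDiff_mappingTorusDeck (ρ.prodCongr ψ) n
    have key := (pushedCharts_lift (ρ := ρ) (ψ := ψ)).hasMFDerivAt_of_deck (I := model E)
      (φ := mappingTorusDeck (ρ.prodCongr ψ) n) (z := z) (hd.mdifferentiable (by simp) z)
      (Prod.ext h1 h2) (fun z => ((MappingTorus.mk_eq_iff (ρ.prodCongr ψ)).2 ⟨n, rfl, rfl⟩).symm)
    have e : mappingTorusDeck (ρ.prodCongr ψ) n =
        Prod.map (Prod.map ⇑((ρ.toEquiv : Equiv.Perm (Torus Γ)) ^ n)
          ⇑((ψ.toEquiv : Equiv.Perm N) ^ n)) (fun t : ℝ => t + n) := by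
      funext z
      simp only [mappingTorusDeck, prodCongr_zpow]
      rfl
    have ht : HasMFDerivAt 𝓘(ℝ, ℝ) 𝓘(ℝ, ℝ) (fun t : ℝ => t + n) z.2
        (ContinuousLinearMap.id ℝ ℝ) :=
      ((hasFDerivAt_id z.2).add_const (n : ℝ)).hasMFDerivAt
    have hr := (contMDiff_zpow ρ n).mdifferentiable (by simp) z.1.1
    have hp := (contMDiff_zpow ψ n).mdifferentiable (by simp) z.1.2
    rw [e, mfderiv_prodMap (hr.prodMap hp) ht.mdifferentiableAt, mfderiv_prodMap hr hp,
      ht.mfderiv] at key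
    exact key

end Lift

/-! ### The tensors of the mapping torus in its charts -/

section BlockCharts

variable {E : Type*} [NormedAddCommGroup E] [NormedSpace ℝ E]
  {N : Type*} [TopologicalSpace N] [ChartedSpace E N] [IsManifold 𝓘(ℝ, E) ∞ N]
  {Γ : Submodule ℤ (Fin 3 → ℝ)} [DiscreteTopology Γ]
  {ρ : Torus Γ ≃ₘ^∞⟮𝓘(ℝ, Fin 3 → ℝ), 𝓘(ℝ, Fin 3 → ℝ)⟯ Torus Γ}
  {ψ : N ≃ₘ^∞⟮𝓘(ℝ, E), 𝓘(ℝ, E)⟯ N}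

omit [IsManifold 𝓘(ℝ, E) ∞ N] in
theorem extChartAt_lift (z : (Torus Γ × N) × ℝ) : extChartAt (model E) z =
    ((extChartAt 𝓘(ℝ, Fin 3 → ℝ) z.1.1).prod (extChartAt 𝓘(ℝ, E) z.1.2)).prod
      (PartialEquiv.refl ℝ) := by
  rw [extChartAt_prod, extChartAt_prod, extChartAt_model_space_eq_id]

omit [IsManifold 𝓘(ℝ, E) ∞ N] in
theorem extChartAt_blockTorus_self (m : BlockTorus ρ ψ) :
    (extChartAt (model E) m m).1.2 = extChartAt 𝓘(ℝ, E) (base m) (base m) ∧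
      (extChartAt (model E) m m).2 = time m := by
  rw [pushedCharts_lift.extChartAt_self, extChartAt_lift]
  exact ⟨rfl, rfl⟩

theorem hasMFDerivAt_extChartAt_lift_symm (z : (Torus Γ × N) × ℝ) {w : BlockSpace E}
    (hw : w.1.2 ∈ (extChartAt 𝓘(ℝ, E) z.1.2).target) :
    HasMFDerivAt 𝓘(ℝ, BlockSpace E) (model E) (extChartAt (model E) z).symm w
      (blockDeriv (ContinuousLinearMap.id ℝ (Fin 3 → ℝ)) (chartDeriv 𝓘(ℝ, E) z.1.2 w.1.2)) := by
  have e : ((extChartAt (model E) z).symm : BlockSpace E → (Torus Γ × N) × ℝ) = fun w =>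
      (((extChartAt 𝓘(ℝ, Fin 3 → ℝ) z.1.1).symm w.1.1, (extChartAt 𝓘(ℝ, E) z.1.2).symm w.1.2),
        w.2) := by
    rw [extChartAt_lift]
    rfl
  have hT := (Torus.hasMFDerivAt_extChartAt_symm Γ z.1.1 w.1.1).comp w
    (((ContinuousLinearMap.fst ℝ (Fin 3 → ℝ) E) ∘L
      (ContinuousLinearMap.fst ℝ ((Fin 3 → ℝ) × E) ℝ)).hasFDerivAt (x := w)).hasMFDerivAt
  have hd : MDifferentiableAt 𝓘(ℝ, E) 𝓘(ℝ, E) (extChartAt 𝓘(ℝ, E) z.1.2).symm w.1.2 :=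
    ((contMDiffOn_extChartAt_symm (n := ∞) z.1.2).contMDiffAt
      (extChartAt_target_mem_nhds' hw)).mdifferentiableAt (by simp)
  have hE := hd.hasMFDerivAt.comp w ((toE (E := E)).hasFDerivAt (x := w)).hasMFDerivAt
  have ht := ((tim (E := E)).hasFDerivAt (x := w)).hasMFDerivAt
  have h := (hT.prodMk hE).prodMk ht
  rw [e]
  exact h

theorem exists_chartDeriv {κ : ℝ} (hκ : κ ≠ 0)
    (hρ : ∀ x, IsTwistedSimilarity κ (mfderiv 𝓘(ℝ, Fin 3 → ℝ) 𝓘(ℝ, Fin 3 → ℝ) ρ x))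
    (m₀ : BlockTorus ρ ψ) {w : BlockSpace E} (hw : w ∈ (extChartAt (model E) m₀).target) :
    w.1.2 ∈ (extChartAt 𝓘(ℝ, E) (base m₀)).target ∧
    ∃ (n : ℤ) (R : (Fin 3 → ℝ) →L[ℝ] (Fin 3 → ℝ)), IsTwistedSimilarity (κ ^ n) R ∧
      base ((extChartAt (model E) m₀).symm w) =
        ((ψ.toEquiv : Equiv.Perm N) ^ n) ((extChartAt 𝓘(ℝ, E) (base m₀)).symm w.1.2) ∧
      time ((extChartAt (model E) m₀).symm w) = w.2 + n ∧
      chartDeriv (model E) m₀ w = blockDeriv R (derivAt ⇑((ψ.toEquiv : Equiv.Perm N) ^ n)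
        ((extChartAt 𝓘(ℝ, E) (base m₀)).symm w.1.2) ∘L
          chartDeriv 𝓘(ℝ, E) (base m₀) w.1.2) := by
  have hw' := pushedCharts_lift.extChartAt_target_subset (I := model E) m₀ hw
  have hwE : w.1.2 ∈ (extChartAt 𝓘(ℝ, E) (base m₀)).target := by
    rw [extChartAt_lift] at hw'
    exact hw'.1.2
  have hs := (pushedCharts_lift (ρ := ρ) (ψ := ψ)).extChartAt_symm_eq (I := model E) m₀
  set z := (extChartAt (model E) (lift m₀)).symm w with hz
  have hzE : z.1.2 = (extChartAt 𝓘(ℝ, E) (base m₀)).symm w.1.2 := by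
    rw [hz, extChartAt_lift]
    rfl
  have hzt : z.2 = w.2 := by
    rw [hz, extChartAt_lift]
    rfl
  obtain ⟨n, R, hR, hb, ht, hd⟩ := exists_hasMFDerivAt_mk (ψ := ψ) hκ hρ z
  have h := hd.comp w (hasMFDerivAt_extChartAt_lift_symm (lift m₀) hwE)
  rw [hzE] at hb h
  rw [hzt] at ht
  rw [← hs] at h
  refine ⟨hwE, n, R, hR, ?_, ?_, h.mfderiv⟩
  · rw [hs]; exact hb
  · rw [hs]; exact ht

/-! ### Tensors on the mapping torus -/

variable (ρ ψ) in
/-- The endomorphism field on the mapping torus with blocks `∂₀ ↦ σ exp (c t) ∂ₜ`, `∂₁ ↦ ∂₂`,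
`J`. -/
def torusEnd (σ c : ℝ) (J : EndField 𝓘(ℝ, E) N) : EndField (model E) (BlockTorus ρ ψ) := fun m =>
  blockEnd σ (Real.exp (c * time m)) (Real.exp (-(c * time m))) (endAt J (base m))

variable (ρ ψ) in
/-- The bilinear form on the mapping torus with blocks `exp (2 c t) dx₀²`,
`exp (-c t) (dx₁² + dx₂²)`, `dt²`, `k`. -/
def torusBilin (c : ℝ)
    (k : ∀ x : N, TangentSpace 𝓘(ℝ, E) x →L[ℝ] TangentSpace 𝓘(ℝ, E) x →L[ℝ] ℝ)
    (m : BlockTorus ρ ψ) :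
    TangentSpace (model E) m →L[ℝ] TangentSpace (model E) m →L[ℝ] ℝ :=
  (blockBilin (Real.exp (c * time m)) (Real.exp (-(c * time m))) (bilinAt k (base m)) :
    BlockSpace E →L[ℝ] BlockSpace E →L[ℝ] ℝ)

variable (ρ ψ) in
/-- The 2-form on the mapping torus with blocks `σ exp (c t) dx₀ ∧ dt`, `exp (-c t) dx₁ ∧ dx₂`,
`Ω`. -/
def torusForm (σ c : ℝ) (Ω : DForm 𝓘(ℝ, E) N 2) : DForm (model E) (BlockTorus ρ ψ) 2 := fun m =>
  blockForm σ (Real.exp (c * time m)) (Real.exp (-(c * time m))) (formAt Ω (base m))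

theorem exp_add_int (c s : ℝ) (n : ℤ) :
    Real.exp (c * (s + n)) = Real.exp (c * s) * Real.exp c ^ n := by
  rw [mul_add, Real.exp_add, Real.exp_mul c n, Real.rpow_intCast]

theorem exp_neg_add_int (c s : ℝ) (n : ℤ) :
    Real.exp (-(c * (s + n))) = Real.exp (-(c * s)) * (Real.exp c ^ n)⁻¹ := by
  rw [Real.exp_neg, exp_add_int, mul_inv, Real.exp_neg]

variable {c : ℝ}
  (hρ : ∀ x, IsTwistedSimilarity (Real.exp c) (mfderiv 𝓘(ℝ, Fin 3 → ℝ) 𝓘(ℝ, Fin 3 → ℝ) ρ x))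
include hρ

/-- The value at a point involves the arbitrary integer `n` of `exists_chartDeriv`. It enters the
coefficients as `exp (c (t + n)) = exp (c t) κ ^ n` and the differential through the `n`-th iterates
of `ρ` and `ψ`; by `blockEnd_blockDeriv` the two effects cancel. -/
theorem chartEnd_torusEnd {J : EndField 𝓘(ℝ, E) N} (hJ : PreservesEnd J ψ) (σ : ℝ)
    (m₀ : BlockTorus ρ ψ) {w : BlockSpace E} (hw : w ∈ (extChartAt (model E) m₀).target) :
    chartEnd (torusEnd ρ ψ σ c J) m₀ w = blockEndField σ c (chartEnd J (base m₀)) w := by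
  obtain ⟨hwE, n, R, hR, hb, ht, hd⟩ := exists_chartDeriv (Real.exp_pos c).ne' hρ m₀ hw
  have h1 : endAt (torusEnd ρ ψ σ c J) ((extChartAt (model E) m₀).symm w) ∘L
      chartDeriv (model E) m₀ w =
      chartDeriv (model E) m₀ w ∘L blockEndField σ c (chartEnd J (base m₀)) w := by
    rw [hd]
    refine ContinuousLinearMap.ext fun v => ?_
    have e : endAt (torusEnd ρ ψ σ c J) ((extChartAt (model E) m₀).symm w) =
        blockEnd σ (Real.exp (c * w.2) * Real.exp c ^ n)
          (Real.exp (-(c * w.2)) * (Real.exp c ^ n)⁻¹)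
          (endAt J (((ψ.toEquiv : Equiv.Perm N) ^ n)
            ((extChartAt 𝓘(ℝ, E) (base m₀)).symm w.1.2))) := by
      rw [← exp_add_int, ← exp_neg_add_int, ← hb, ← ht]
      rfl
    rw [e, ContinuousLinearMap.comp_apply, ContinuousLinearMap.comp_apply, blockEndField]
    have hS : ∀ v, chartDeriv 𝓘(ℝ, E) (base m₀) w.1.2 (chartEnd J (base m₀) w.1.2 v) =
        endAt J ((extChartAt 𝓘(ℝ, E) (base m₀)).symm w.1.2)
          (chartDeriv 𝓘(ℝ, E) (base m₀) w.1.2 v) := fun v =>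
      congrArg (fun T : E →L[ℝ] E => T (endAt J ((extChartAt 𝓘(ℝ, E) (base m₀)).symm w.1.2)
          (chartDeriv 𝓘(ℝ, E) (base m₀) w.1.2 v))) (chartDeriv_comp_chartDerivInv hwE)
    refine blockEnd_blockDeriv (zpow_ne_zero n (Real.exp_pos c).ne') hR (fun v => ?_) _ _ _ v
    rw [ContinuousLinearMap.comp_apply, ContinuousLinearMap.comp_apply, ← hJ.zpow, hS]
  rw [chartEnd_eq, h1, ← ContinuousLinearMap.comp_assoc, chartDerivInv_comp_chartDeriv hw,
    ContinuousLinearMap.id_comp]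

theorem chartBilin_torusBilin
    {k : ∀ x : N, TangentSpace 𝓘(ℝ, E) x →L[ℝ] TangentSpace 𝓘(ℝ, E) x →L[ℝ] ℝ}
    (hk : PreservesBilin k ψ) (m₀ : BlockTorus ρ ψ) {w : BlockSpace E}
    (hw : w ∈ (extChartAt (model E) m₀).target) :
    chartBilin (torusBilin ρ ψ c k) m₀ w = blockBilinField c (chartBilin k (base m₀)) w := by
  obtain ⟨hwE, n, R, hR, hb, ht, hd⟩ := exists_chartDeriv (Real.exp_pos c).ne' hρ m₀ hw
  refine ContinuousLinearMap.ext fun u => ContinuousLinearMap.ext fun v => ?_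
  rw [chartBilin_apply, hd]
  have e : bilinAt (torusBilin ρ ψ c k) ((extChartAt (model E) m₀).symm w) =
      blockBilin (Real.exp (c * w.2) * Real.exp c ^ n)
        (Real.exp (-(c * w.2)) * (Real.exp c ^ n)⁻¹)
        (bilinAt k (((ψ.toEquiv : Equiv.Perm N) ^ n)
          ((extChartAt 𝓘(ℝ, E) (base m₀)).symm w.1.2))) := by
    rw [← exp_add_int, ← exp_neg_add_int, ← hb, ← ht]
    rfl
  rw [e]
  refine blockBilin_blockDeriv (zpow_ne_zero n (Real.exp_pos c).ne') hR (fun u v => ?_) _ _ u v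
  rw [ContinuousLinearMap.comp_apply, ContinuousLinearMap.comp_apply, hk.zpow]
  rfl

theorem chartForm_torusForm {Ω : DForm 𝓘(ℝ, E) N 2}
    (hΩ : ∀ (n : ℤ) (p : N), (formAt Ω (((ψ.toEquiv : Equiv.Perm N) ^ n) p)).compContinuousLinearMap
      (derivAt ⇑((ψ.toEquiv : Equiv.Perm N) ^ n) p) = formAt Ω p) (σ : ℝ)
    (m₀ : BlockTorus ρ ψ) {w : BlockSpace E} (hw : w ∈ (extChartAt (model E) m₀).target) :
    chartForm (torusForm ρ ψ σ c Ω) m₀ w = blockFormField σ c (chartForm Ω (base m₀)) w := by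
  obtain ⟨hwE, n, R, hR, hb, ht, hd⟩ := exists_chartDeriv (Real.exp_pos c).ne' hρ m₀ hw
  change (formAt (torusForm ρ ψ σ c Ω) ((extChartAt (model E) m₀).symm w)).compContinuousLinearMap
    (chartDeriv (model E) m₀ w) = _
  have e : formAt (torusForm ρ ψ σ c Ω) ((extChartAt (model E) m₀).symm w) =
      blockForm σ (Real.exp (c * w.2) * Real.exp c ^ n)
        (Real.exp (-(c * w.2)) * (Real.exp c ^ n)⁻¹)
        (formAt Ω (((ψ.toEquiv : Equiv.Perm N) ^ n)
          ((extChartAt 𝓘(ℝ, E) (base m₀)).symm w.1.2))) := by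
    rw [← exp_add_int, ← exp_neg_add_int, ← hb, ← ht]
    rfl
  rw [e, hd]
  refine blockForm_blockDeriv (zpow_ne_zero n (Real.exp_pos c).ne') hR ?_ _ _ _
  exact congrArg (fun η : E [⋀^Fin 2]→L[ℝ] ℝ => η.compContinuousLinearMap
    (chartDeriv 𝓘(ℝ, E) (base m₀) w.1.2)) (hΩ n _)

theorem chartForm_torVol (α : DForm (model E) (BlockTorus ρ ψ) 3) (r : ℝ)
    (hα : ∀ m, formAt α m = r • torVol) (m₀ : BlockTorus ρ ψ) {w : BlockSpace E}
    (hw : w ∈ (extChartAt (model E) m₀).target) : chartForm α m₀ w = r • torVol := by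
  obtain ⟨hwE, n, R, hR, hb, ht, hd⟩ := exists_chartDeriv (Real.exp_pos c).ne' hρ m₀ hw
  change (formAt α ((extChartAt (model E) m₀).symm w)).compContinuousLinearMap
    (chartDeriv (model E) m₀ w) = _
  have h := torVol_blockDeriv (zpow_ne_zero n (Real.exp_pos c).ne') hR (S := derivAt
    ⇑((ψ.toEquiv : Equiv.Perm N) ^ n) ((extChartAt 𝓘(ℝ, E) (base m₀)).symm w.1.2) ∘L
      chartDeriv 𝓘(ℝ, E) (base m₀) w.1.2)
  rw [hα, hd]
  exact congrArg (r • ·) h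

end BlockCharts

/-! ### Alternating forms and positive definite forms -/

section LinearAlgebra

variable {V : Type*} [NormedAddCommGroup V] [NormedSpace ℝ V]

theorem alternating_ext_two {η η' : V [⋀^Fin 2]→L[ℝ] ℝ}
    (h : ∀ u v, η ![u, v] = η' ![u, v]) : η = η' := by
  ext v
  have hv : v = ![v 0, v 1] := by ext i; fin_cases i <;> rfl
  rw [hv, h]

theorem extDeriv_const {n : ℕ} (η : V [⋀^Fin n]→L[ℝ] ℝ) (p : V) :
    extDeriv (fun _ => η) p = 0 := by
  unfold extDeriv
  rw [fderiv_fun_const]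
  exact map_zero (ContinuousAlternatingMap.alternatizeUncurryFinCLM ℝ V ℝ)

/-- `ContinuousLinearMap.inverse` is zero on maps that are not invertible, so this is needed before
the Poisson tensor can be computed. -/
theorem isInvertible_of_pos [FiniteDimensional ℝ V] (B : V →L[ℝ] V →L[ℝ] ℝ)
    (hB : ∀ v, v ≠ 0 → 0 < B v v) : B.IsInvertible := by
  have hinj : Function.Injective (B : V →ₗ[ℝ] V →L[ℝ] ℝ) := by
    rw [← LinearMap.ker_eq_bot, LinearMap.ker_eq_bot']
    intro v hv
    by_contra h
    have := hB v h
    rw [show B v = 0 from hv] at this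
    simp at this
  have hrank : Module.finrank ℝ V = Module.finrank ℝ (V →L[ℝ] ℝ) := by
    rw [← (LinearMap.toContinuousLinearMap (𝕜 := ℝ) (E := V) (F' := ℝ)).finrank_eq]
    exact (Subspace.dual_finrank_eq (K := ℝ) (V := V)).symm
  have hsurj := (LinearMap.injective_iff_surjective_of_finrank_eq_finrank hrank).1 hinj
  exact ⟨(LinearEquiv.ofBijective (B : V →ₗ[ℝ] V →L[ℝ] ℝ) ⟨hinj, hsurj⟩).toContinuousLinearEquiv,
    ContinuousLinearMap.ext fun _ => rfl⟩

end LinearAlgebra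

/-! ### Commutator and positivity of the block tensors -/

section Block

variable {E : Type*} [NormedAddCommGroup E] [NormedSpace ℝ E]

theorem blockEnd_ofE (σ a b : ℝ) (A : E →L[ℝ] E) (v : E) :
    blockEnd σ a b A (ofE v) = ofE (A v) := by
  rw [blockEnd_apply]
  refine Prod.ext (Prod.ext ?_ rfl) (by simp)
  ext i
  fin_cases i <;> simp

/-- The two endomorphisms agree on the `(x₁, x₂)` plane and are opposite on the `(x₀, t)` plane, so
they commute off `E`. -/
theorem blockEnd_commutator (a b : ℝ) (A A' : E →L[ℝ] E) (v : BlockSpace E) :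
    blockEnd 1 a b A (blockEnd (-1) a b A' v) - blockEnd (-1) a b A' (blockEnd 1 a b A v) =
      ofE (A (A' v.1.2) - A' (A v.1.2)) := by
  simp only [blockEnd_apply]
  refine Prod.ext (Prod.ext ?_ rfl) (by simp)
  ext i
  fin_cases i <;> simp

theorem blockBilin_pos {a b : ℝ} (ha : 0 < a) (hb : 0 < b) {B : E →L[ℝ] E →L[ℝ] ℝ}
    (hB : ∀ v, v ≠ 0 → 0 < B v v) (v : BlockSpace E) (hv : v ≠ 0) : 0 < blockBilin a b B v v := by
  have hB' : ∀ v, 0 ≤ B v v := fun v => by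
    rcases eq_or_ne v 0 with rfl | h
    · simp
    · exact (hB v h).le
  have h1 : 0 ≤ a ^ 2 * (v.1.1 0 * v.1.1 0) := mul_nonneg (sq_nonneg _) (mul_self_nonneg _)
  have h2 : 0 ≤ b * (v.1.1 1 * v.1.1 1 + v.1.1 2 * v.1.1 2) :=
    mul_nonneg hb.le (add_nonneg (mul_self_nonneg _) (mul_self_nonneg _))
  have h3 := hB' v.1.2
  have h4 := mul_self_nonneg v.2
  rw [blockBilin_apply]
  by_contra! hle
  apply hv
  have e1 : a ^ 2 * (v.1.1 0 * v.1.1 0) = 0 := by linarith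
  have e2 : b * (v.1.1 1 * v.1.1 1 + v.1.1 2 * v.1.1 2) = 0 := by linarith
  have e3 : B v.1.2 v.1.2 = 0 := by linarith
  have e4 : v.2 * v.2 = 0 := by linarith
  have f1 : v.1.1 0 = 0 := by
    have := (mul_eq_zero.1 e1).resolve_left (pow_pos ha 2).ne'
    exact mul_self_eq_zero.1 this
  have f2 := (mul_eq_zero.1 e2).resolve_left hb.ne'
  obtain ⟨f3, f4⟩ := mul_self_add_mul_self_eq_zero.1 f2
  refine Prod.ext (Prod.ext ?_ ?_) (mul_self_eq_zero.1 e4)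
  · ext i
    fin_cases i
    · exact f1
    · exact f3
    · exact f4
  · by_contra h
    exact (hB _ h).ne' e3

theorem isBounded_blockBilin {a b : ℝ} (ha : 0 < a) (hb : 0 < b) {B : E →L[ℝ] E →L[ℝ] ℝ}
    (hB : ∀ v, 0 ≤ B v v) (hbd : Bornology.IsBounded {v | B v v < 1}) :
    Bornology.IsBounded {v | blockBilin a b B v v < 1} := by
  -- A single radius for all coordinates: it only has to satisfy `a r ≥ 1`, `b r ≥ 1` and `r ≥ 1`.
  set r := 1 / a + 1 / b + 1 with hr
  have hra : 1 ≤ a * r := by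
    rw [hr]; field_simp; nlinarith [mul_pos ha hb]
  have hrb : 1 ≤ b * r := by
    rw [hr]; field_simp; nlinarith [mul_pos ha hb]
  have hr1 : 1 ≤ r := by
    have := one_div_pos.2 ha; have := one_div_pos.2 hb; linarith
  refine (((Metric.isBounded_closedBall (x := (0 : Fin 3 → ℝ)) (r := r)).prod hbd).prod
    (Metric.isBounded_closedBall (x := (0 : ℝ)) (r := r))).subset ?_
  intro v hv
  have hv' : blockBilin a b B v v < 1 := hv
  rw [blockBilin_apply] at hv'
  have h1 : 0 ≤ a ^ 2 * (v.1.1 0 * v.1.1 0) := mul_nonneg (sq_nonneg _) (mul_self_nonneg _)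
  have h2 : 0 ≤ b * (v.1.1 1 * v.1.1 1) := mul_nonneg hb.le (mul_self_nonneg _)
  have h2' : 0 ≤ b * (v.1.1 2 * v.1.1 2) := mul_nonneg hb.le (mul_self_nonneg _)
  have h3 := hB v.1.2
  have h4 := mul_self_nonneg v.2
  rw [mul_add] at hv'
  have hbr : ∀ s : ℝ, b * (s * s) < 1 → |s| ≤ r := fun s hs => by
    refine abs_le_of_sq_le_sq ?_ (by linarith)
    have : b * (s * s) ≤ b * (r * r) := by nlinarith
    have := le_of_mul_le_mul_left this hb
    nlinarith
  refine ⟨⟨?_, ?_⟩, ?_⟩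
  · rw [mem_closedBall_zero_iff, pi_norm_le_iff_of_nonneg (by linarith)]
    intro i
    fin_cases i
    · have h5 : |a * v.1.1 0| ≤ a * r := abs_le_of_sq_le_sq (by nlinarith) (by linarith)
      rw [abs_mul, abs_of_pos ha] at h5
      exact le_of_mul_le_mul_left h5 ha
    · exact hbr (v.1.1 1) (by linarith)
    · exact hbr (v.1.1 2) (by linarith)
  · change B v.1.2 v.1.2 < 1
    linarith
  · rw [mem_closedBall_zero_iff]
    exact abs_le_of_sq_le_sq (by nlinarith) (by linarith)

end Block

/-! ### Regularity of fundamental forms -/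

section HermitianCharts

variable {E : Type*} [NormedAddCommGroup E] [NormedSpace ℝ E]
  {H : Type*} [TopologicalSpace H] {I : ModelWithCorners ℝ E H} [I.Boundaryless]
  {M : Type*} [TopologicalSpace M] [ChartedSpace H M] [IsManifold I ∞ M]
  {g : Metric I M} {J : EndField I M} {Ω : DForm I M 2}

omit [I.Boundaryless] in
theorem IsHermitian.formAt_eq (h : IsHermitian g J Ω) (x : M) (u v : E) :
    formAt Ω x ![u, v] = bilinAt g.inner x (endAt J x u) v := h.form x u v

theorem IsHermitian.chartForm_eq (h : IsHermitian g J Ω) {x₀ : M} {u : E}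
    (hu : u ∈ (extChartAt I x₀).target) :
    chartForm Ω x₀ u = alternation (chartBilin g.inner x₀ u ∘L chartEnd J x₀ u) := by
  refine eq_alternation fun v w => ?_
  have e : (fun i => chartDeriv I x₀ u (![v, w] i)) =
      ![chartDeriv I x₀ u v, chartDeriv I x₀ u w] := by
    ext i; fin_cases i <;> rfl
  have hJ : chartDeriv I x₀ u (chartEnd J x₀ u v) =
      endAt J ((extChartAt I x₀).symm u) (chartDeriv I x₀ u v) :=
    congrArg (fun T : E →L[ℝ] E => T (endAt J ((extChartAt I x₀).symm u) (chartDeriv I x₀ u v)))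
      (chartDeriv_comp_chartDerivInv hu)
  rw [chartForm_apply, e, h.formAt_eq, ContinuousLinearMap.comp_apply, chartBilin_apply, hJ]

set_option maxSynthPendingDepth 3 in
-- Regularity of the fundamental form is not part of the definitions; it comes from the smoothness
-- of the metric and of `J`.
theorem IsHermitian.differentiableAt_chartForm (h : IsHermitian g J Ω) (hJ : SmoothEnd J) (x : M) :
    DifferentiableAt ℝ (chartForm Ω x) (extChartAt I x x) := by
  have h1 := (smoothEnd_iff J).1 hJ x
  have h2 := (contMDiff_bilin_iff g.inner).1 g.contMDiff x
  have h3 : DifferentiableAt ℝ (fun u => alternation (chartBilin g.inner x u ∘L chartEnd J x u))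
      (extChartAt I x x) :=
    ((alternation (V := E)).differentiableAt).comp _ ((h2.clm_comp h1).differentiableAt (by simp))
  refine h3.congr_of_eventuallyEq ?_
  filter_upwards [extChartAt_target_mem_nhds (I := I) x] with u hu
  exact h.chartForm_eq hu

end HermitianCharts

/-! ### Metric, complex structures and torsion of the mapping torus -/

section BlockStructures

variable {E : Type*} [NormedAddCommGroup E] [NormedSpace ℝ E]
  {N : Type*} [TopologicalSpace N] [ChartedSpace E N] [IsManifold 𝓘(ℝ, E) ∞ N]
  {Γ : Submodule ℤ (Fin 3 → ℝ)} [DiscreteTopology Γ]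
  {ρ : Torus Γ ≃ₘ^∞⟮𝓘(ℝ, Fin 3 → ℝ), 𝓘(ℝ, Fin 3 → ℝ)⟯ Torus Γ}
  {ψ : N ≃ₘ^∞⟮𝓘(ℝ, E), 𝓘(ℝ, E)⟯ N} {c : ℝ}
  (hρ : ∀ x, IsTwistedSimilarity (Real.exp c) (mfderiv 𝓘(ℝ, Fin 3 → ℝ) 𝓘(ℝ, Fin 3 → ℝ) ρ x))
  {J : EndField 𝓘(ℝ, E) N} {Ω : DForm 𝓘(ℝ, E) N 2} {k : Metric 𝓘(ℝ, E) N}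

theorem bilinAt_pos (k : Metric 𝓘(ℝ, E) N) (p : N) (v : E) (hv : v ≠ 0) :
    0 < bilinAt k.inner p v v := k.pos p v hv

theorem bilinAt_nonneg (k : Metric 𝓘(ℝ, E) N) (p : N) (v : E) : 0 ≤ bilinAt k.inner p v v := by
  rcases eq_or_ne v 0 with rfl | h
  · simp
  · exact (bilinAt_pos k p v h).le

theorem isBounded_bilinAt (k : Metric 𝓘(ℝ, E) N) (p : N) :
    Bornology.IsBounded {v : E | bilinAt k.inner p v v < 1} := by
  have h : Bornology.IsVonNBounded ℝ {v : E | bilinAt k.inner p v v < 1} := k.isVonNBounded p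
  exact NormedSpace.isVonNBounded_iff ℝ |>.1 h

omit [IsManifold 𝓘(ℝ, E) ∞ N] in
theorem eventually_mem_target (m : BlockTorus ρ ψ) :
    ∀ᶠ w in 𝓝 (extChartAt (model E) m m), w ∈ (extChartAt (model E) m).target :=
  extChartAt_target_mem_nhds m

/-- The metric on the mapping torus with blocks `exp (2 c t) dx₀²`, `exp (-c t) (dx₁² + dx₂²)`,
`dt²`, `k`. -/
def torusMetric (k : Metric 𝓘(ℝ, E) N) (hk : PreservesBilin k.inner ψ) :
    Metric (model E) (BlockTorus ρ ψ) where
  inner := torusBilin ρ ψ c k.inner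
  symm m u v := by
    have h : ∀ u v : E, bilinAt k.inner (base m) u v = bilinAt k.inner (base m) v u :=
      k.symm (base m)
    have key : ∀ u v : BlockSpace E,
        blockBilin (Real.exp (c * time m)) (Real.exp (-(c * time m)))
          (bilinAt k.inner (base m)) u v =
        blockBilin (Real.exp (c * time m)) (Real.exp (-(c * time m)))
          (bilinAt k.inner (base m)) v u := fun u v => by
      rw [blockBilin_apply, blockBilin_apply, h]
      ring
    exact key u v
  pos m v hv := blockBilin_pos (Real.exp_pos _) (Real.exp_pos _) (bilinAt_pos k (base m)) v hv
  isVonNBounded m := (NormedSpace.isVonNBounded_iff ℝ).2 <|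
    isBounded_blockBilin (Real.exp_pos _) (Real.exp_pos _) (bilinAt_nonneg k (base m))
      (isBounded_bilinAt k (base m))
  contMDiff := by
    rw [contMDiff_bilin_iff]
    intro m
    have h2 := (contMDiff_bilin_iff k.inner).1 k.contMDiff (base m)
    rw [← (extChartAt_blockTorus_self m).1] at h2
    refine (contDiffAt_blockBilinField c h2).congr_of_eventuallyEq ?_
    filter_upwards [eventually_mem_target m] with w hw
    exact chartBilin_torusBilin hρ hk m hw

include hρ

theorem isComplexStructure_torusEnd (hJ : IsComplexStructure J) (hψ : PreservesEnd J ψ) {σ : ℝ}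
    (hσ : σ * σ = 1) : IsComplexStructure (torusEnd ρ ψ σ c J) := by
  have hev : ∀ m : BlockTorus ρ ψ, chartEnd (torusEnd ρ ψ σ c J) m =ᶠ[𝓝 (extChartAt (model E) m m)]
      blockEndField σ c (chartEnd J (base m)) := fun m => by
    filter_upwards [eventually_mem_target m] with w hw
    exact chartEnd_torusEnd hρ hψ σ m hw
  have hsm : ∀ m : BlockTorus ρ ψ,
      ContDiffAt ℝ ∞ (chartEnd J (base m)) (extChartAt (model E) m m).1.2 := fun m => by
    rw [(extChartAt_blockTorus_self m).1]
    exact (smoothEnd_iff J).1 hJ.smooth (base m)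
  refine ⟨(smoothEnd_iff _).2 fun m => ?_, fun m v => ?_, fun m u v => ?_⟩
  · exact (contDiffAt_blockEndField σ c (hsm m)).congr_of_eventuallyEq (hev m)
  · have hsq : ∀ v : E, endAt J (base m) (endAt J (base m) v) = -v := hJ.sq (base m)
    exact blockEnd_blockEnd hσ (exp_mul_exp_neg c (time m)) hsq v
  · rw [nijenhuis_eq, nijenhuisAt_congr (hev m)]
    refine nijenhuisAt_blockEndField σ c ((hsm m).differentiableAt (by simp)) (fun u v => ?_) u v
    rw [(extChartAt_blockTorus_self m).1, ← nijenhuis_eq]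
    exact hJ.integrable (base m) u v

theorem isHermitian_torusMetric (h : IsHermitian k J Ω) (hk : PreservesBilin k.inner ψ) {σ : ℝ}
    (hσ : σ * σ = 1) :
    IsHermitian (torusMetric hρ k hk) (torusEnd ρ ψ σ c J) (torusForm ρ ψ σ c Ω) := by
  refine ⟨fun m u v => ?_, fun m u v => ?_⟩
  · have ho : ∀ u v : E, bilinAt k.inner (base m) (endAt J (base m) u) (endAt J (base m) v) =
        bilinAt k.inner (base m) u v := h.orthogonal (base m)
    exact blockBilin_blockEnd hσ (exp_mul_exp_neg c (time m)) ho u v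
  · exact blockForm_eq (exp_mul_exp_neg c (time m)) (h.formAt_eq (base m)) u v

theorem dc_torusForm (hJ : SmoothEnd J) (h : IsHermitian k J Ω) (hd : ∀ x, extD Ω x = 0)
    (hψ : PreservesEnd J ψ) (hk : PreservesBilin k.inner ψ) (σ : ℝ) (m : BlockTorus ρ ψ) :
    formAt (dc (torusEnd ρ ψ σ c J) (torusForm ρ ψ σ c Ω)) m = (c * σ) • torVol := by
  -- The form is determined by `J` and `k`, both preserved by the iterates of `ψ`.
  have hΩ : ∀ (n : ℤ) (p : N),
      (formAt Ω (((ψ.toEquiv : Equiv.Perm N) ^ n) p)).compContinuousLinearMap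
        (derivAt ⇑((ψ.toEquiv : Equiv.Perm N) ^ n) p) = formAt Ω p := fun n p => by
    refine alternating_ext_two fun u v => ?_
    have e : (⇑(derivAt ⇑((ψ.toEquiv : Equiv.Perm N) ^ n) p) ∘ ![u, v] : Fin 2 → E) =
        ![derivAt ⇑((ψ.toEquiv : Equiv.Perm N) ^ n) p u,
          derivAt ⇑((ψ.toEquiv : Equiv.Perm N) ^ n) p v] := by
      ext i; fin_cases i <;> rfl
    rw [ContinuousAlternatingMap.compContinuousLinearMap_apply, e, h.formAt_eq, h.formAt_eq,
      ← hψ.zpow, hk.zpow]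
  have hb := extChartAt_blockTorus_self m
  have : IsManifold (model E) 1 (BlockTorus ρ ψ) := IsManifold.of_le (n := ∞) (by simp)
  have : IsManifold 𝓘(ℝ, E) 1 N := IsManifold.of_le (n := ∞) (by simp)
  have hη : DifferentiableAt ℝ (chartForm Ω (base m)) (extChartAt (model E) m m).1.2 := by
    rw [hb.1]
    exact h.differentiableAt_chartForm hJ (base m)
  have hd' : extDeriv (chartForm Ω (base m)) (extChartAt (model E) m m).1.2 = 0 := by
    rw [hb.1, ← extD_eq]
    exact hd (base m)
  have hev : chartForm (torusForm ρ ψ σ c Ω) m =ᶠ[𝓝 (extChartAt (model E) m m)]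
      blockFormField σ c (chartForm Ω (base m)) := by
    filter_upwards [eventually_mem_target m] with w hw
    exact chartForm_torusForm hρ hΩ σ m hw
  have key : (formAt (extD (torusForm ρ ψ σ c Ω)) m) =
      (-c * Real.exp (-(c * time m))) • wedge (tim (E := E)) (wedge₂ (tor 1) (tor 2)) := by
    rw [← hb.2, ← extDeriv_blockFormField σ c hη hd', ← hev.extDeriv_eq]
    exact extD_eq _ _
  change (formAt (extD (torusForm ρ ψ σ c Ω)) m).compContinuousLinearMap
    (-blockEnd σ (Real.exp (c * time m)) (Real.exp (-(c * time m))) (endAt J (base m))) = _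
  rw [key, wedge_tim_blockEnd _ _ (exp_mul_exp_neg c (time m))]
  ring_nf

theorem extD_of_eq_torVol (α : DForm (model E) (BlockTorus ρ ψ) 3) (r : ℝ)
    (hα : ∀ m, formAt α m = r • torVol) (m : BlockTorus ρ ψ) : extD α m = 0 := by
  have : IsManifold (model E) 1 (BlockTorus ρ ψ) := IsManifold.of_le (n := ∞) (by simp)
  refine (extD_eq α m).trans ?_
  have hev : chartForm α m =ᶠ[𝓝 (extChartAt (model E) m m)] fun _ => r • torVol := by
    filter_upwards [eventually_mem_target m] with w hw
    exact chartForm_torVol hρ α r hα m hw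
  rw [hev.extDeriv_eq]
  exact extDeriv_const _ _

omit hρ

omit [IsManifold 𝓘(ℝ, E) ∞ N] in
-- An iterate of `ψ` appears because the tangent space at the image point is read at the chosen
-- representative, not at `((x, p), t)`.
theorem exists_dfibre {κ : ℝ} (hκ : κ ≠ 0)
    (hρ : ∀ x, IsTwistedSimilarity κ (mfderiv 𝓘(ℝ, Fin 3 → ℝ) 𝓘(ℝ, Fin 3 → ℝ) ρ x))
    (x : Torus Γ) (t : ℝ) (p : N) :
    ∃ n : ℤ, base (fibre ρ ψ x t p) = ((ψ.toEquiv : Equiv.Perm N) ^ n) p ∧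
      ∀ X : E, (dfibre ρ ψ x t p X : BlockSpace E) =
        ofE (derivAt ⇑((ψ.toEquiv : Equiv.Perm N) ^ n) p X) := by
  obtain ⟨n, R, -, hb, -, hd⟩ := exists_hasMFDerivAt_mk (ψ := ψ) hκ hρ ((x, p), t)
  refine ⟨n, hb, fun X => ?_⟩
  have h1 : HasMFDerivAt 𝓘(ℝ, E) (model E) (fun p : N => ((x, p), t)) p (ofE (E := E)) :=
    ((hasMFDerivAt_const x p).prodMk (hasMFDerivAt_id p)).prodMk (hasMFDerivAt_const t p)
  have h2 := (hd.comp p h1).mfderiv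
  have h3 : (dfibre ρ ψ x t p X : BlockSpace E) =
      blockDeriv R (derivAt ⇑((ψ.toEquiv : Equiv.Perm N) ^ n) p) (ofE X) :=
    congrArg (fun T : E →L[ℝ] BlockSpace E => T X) h2
  rw [h3]
  exact Prod.ext (Prod.ext (map_zero R) rfl) rfl

end BlockStructures

/-! ### The generalized Kähler structure and its Poisson tensor -/

section Conclusion

variable {E : Type*} [NormedAddCommGroup E] [NormedSpace ℝ E]
  {N : Type*} [TopologicalSpace N] [ChartedSpace E N] [IsManifold 𝓘(ℝ, E) ∞ N]
  {Γ : Submodule ℤ (Fin 3 → ℝ)} [DiscreteTopology Γ]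
  {ρ : Torus Γ ≃ₘ^∞⟮𝓘(ℝ, Fin 3 → ℝ), 𝓘(ℝ, Fin 3 → ℝ)⟯ Torus Γ}
  {ψ : N ≃ₘ^∞⟮𝓘(ℝ, E), 𝓘(ℝ, E)⟯ N} {c : ℝ}

omit [IsManifold 𝓘(ℝ, E) ∞ N] in
theorem preservesEnd_of_mfderiv_comp {J : EndField 𝓘(ℝ, E) N}
    (h : ∀ p, mfderiv 𝓘(ℝ, E) 𝓘(ℝ, E) ψ p ∘L J p = J (ψ p) ∘L mfderiv 𝓘(ℝ, E) 𝓘(ℝ, E) ψ p) :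
    PreservesEnd J ψ := fun p v => congrArg (fun T : E →L[ℝ] E => T v) (h p)

/-- The metric is recovered from the form and the complex structure by `k(X, Y) = -Ω(JX, Y)`. -/
theorem preservesBilin_of_pullback {J : EndField 𝓘(ℝ, E) N} {Ω : DForm 𝓘(ℝ, E) N 2}
    {k : Metric 𝓘(ℝ, E) N} (hJ : IsComplexStructure J) (h : IsHermitian k J Ω)
    (hψ : PreservesEnd J ψ) (hΩ : pullback ψ Ω = Ω) : PreservesBilin k.inner ψ := by
  intro p u v
  have hsq : ∀ (q : N) (v : E), endAt J q (endAt J q v) = -v := hJ.sq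
  have e : (⇑(derivAt ψ p) ∘ ![endAt J p u, v] : Fin 2 → E) =
      ![derivAt ψ p (endAt J p u), derivAt ψ p v] := by
    ext i; fin_cases i <;> rfl
  have h1 : formAt Ω (ψ p) (⇑(derivAt ψ p) ∘ ![endAt J p u, v]) = formAt Ω p ![endAt J p u, v] :=
    congrArg (fun α : DForm 𝓘(ℝ, E) N 2 => formAt α p ![endAt J p u, v]) hΩ
  rw [e, h.formAt_eq, h.formAt_eq, hψ, hsq, hsq] at h1
  simpa using h1

theorem isGeneralizedKahler_torus
    (hρ : ∀ x, IsTwistedSimilarity (Real.exp c) (mfderiv 𝓘(ℝ, Fin 3 → ℝ) 𝓘(ℝ, Fin 3 → ℝ) ρ x))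
    {J₁ J₂ J₃ : EndField 𝓘(ℝ, E) N} {Ω₁ Ω₂ Ω₃ : DForm 𝓘(ℝ, E) N 2} {k : Metric 𝓘(ℝ, E) N}
    (hN : IsHyperkahler J₁ J₂ J₃ Ω₁ Ω₂ Ω₃ k) (h₁ : PreservesEnd J₁ ψ) (h₂ : PreservesEnd J₂ ψ)
    (hk : PreservesBilin k.inner ψ) :
    IsGeneralizedKahler (torusEnd ρ ψ 1 c J₁) (torusEnd ρ ψ (-1) c J₂) (torusMetric hρ k hk)
      (torusForm ρ ψ 1 c Ω₁) (torusForm ρ ψ (-1) c Ω₂) := by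
  have d₁ := dc_torusForm hρ hN.complex₁.smooth hN.hermitian₁ hN.closed₁ h₁ hk 1
  have d₂ := dc_torusForm hρ hN.complex₂.smooth hN.hermitian₂ hN.closed₂ h₂ hk (-1)
  refine ⟨isComplexStructure_torusEnd hρ hN.complex₁ h₁ (by norm_num),
    isComplexStructure_torusEnd hρ hN.complex₂ h₂ (by norm_num),
    isHermitian_torusMetric hρ hN.hermitian₁ hk (by norm_num),
    isHermitian_torusMetric hρ hN.hermitian₂ hk (by norm_num), fun m => ?_, fun m => ?_⟩
  · have e : formAt (dc (torusEnd ρ ψ 1 c J₁) (torusForm ρ ψ 1 c Ω₁)) m =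
        -formAt (dc (torusEnd ρ ψ (-1) c J₂) (torusForm ρ ψ (-1) c Ω₂)) m := by
      have key : (c * 1) • torVol (E := E) = -((c * -1) • torVol (E := E)) := by
        ext v
        change c * 1 * torVol v = -(c * -1 * torVol v)
        ring
      exact (d₁ m).trans (key.trans (congrArg Neg.neg (d₂ m)).symm)
    exact e
  · exact extD_of_eq_torVol hρ _ _ d₁ m

omit [IsManifold 𝓘(ℝ, E) ∞ N] in
theorem commutator_torusEnd (J J' : EndField 𝓘(ℝ, E) N) (m : BlockTorus ρ ψ) (v : BlockSpace E) :
    (commutator (torusEnd ρ ψ 1 c J) (torusEnd ρ ψ (-1) c J') m v : BlockSpace E) =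
      ofE (endAt J (base m) (endAt J' (base m) v.1.2) -
        endAt J' (base m) (endAt J (base m) v.1.2)) :=
  blockEnd_commutator _ _ (endAt J (base m)) (endAt J' (base m)) v

/-- The metric is block diagonal, so the `E` component `β` of `g⁻¹ α` is dual under `k` to the
restriction of `α`; half the commutator is `J₃` on this component and zero on the others. -/
theorem poissonTensor_torus [FiniteDimensional ℝ E]
    (hρ : ∀ x, IsTwistedSimilarity (Real.exp c) (mfderiv 𝓘(ℝ, Fin 3 → ℝ) 𝓘(ℝ, Fin 3 → ℝ) ρ x))
    {J₁ J₂ J₃ : EndField 𝓘(ℝ, E) N} {Ω₁ Ω₂ Ω₃ : DForm 𝓘(ℝ, E) N 2} {k : Metric 𝓘(ℝ, E) N}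
    (hN : IsHyperkahler J₁ J₂ J₃ Ω₁ Ω₂ Ω₃ k) (hk : PreservesBilin k.inner ψ)
    (m : BlockTorus ρ ψ) (α : BlockSpace E →L[ℝ] ℝ) :
    ∃ β : E, (∀ Y : E, bilinAt k.inner (base m) β Y = α (ofE Y)) ∧
      (poissonTensor (torusEnd ρ ψ 1 c J₁) (torusEnd ρ ψ (-1) c J₂) (torusMetric hρ k hk) m α :
        BlockSpace E) = ofE (endAt J₃ (base m) β) := by
  set B : BlockSpace E →L[ℝ] BlockSpace E →L[ℝ] ℝ := blockBilin (Real.exp (c * time m))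
    (Real.exp (-(c * time m))) (bilinAt k.inner (base m)) with hB
  have hinv := (isInvertible_of_pos B (blockBilin_pos (Real.exp_pos _) (Real.exp_pos _)
    (bilinAt_pos k (base m)))).self_apply_inverse α
  refine ⟨(B.inverse α).1.2, fun Y => ?_, ?_⟩
  · have h : ∀ w : BlockSpace E, B w (ofE Y) = bilinAt k.inner (base m) w.1.2 Y := fun w => by
      rw [hB, blockBilin_apply]
      simp
    exact (h _).symm.trans (congrArg (fun T : BlockSpace E →L[ℝ] ℝ => T (ofE Y)) hinv)
  · have h12 : ∀ v : E, endAt J₁ (base m) (endAt J₂ (base m) v) = endAt J₃ (base m) v :=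
      hN.quaternion (base m)
    have h21 : ∀ v : E, endAt J₂ (base m) (endAt J₁ (base m) v) = -endAt J₃ (base m) v :=
      hN.anticommute (base m)
    have hc := commutator_torusEnd (c := c) J₁ J₂ m (B.inverse α)
    rw [h12, h21, sub_neg_eq_add, ← two_smul ℝ, map_smul] at hc
    have hp : (poissonTensor (torusEnd ρ ψ 1 c J₁) (torusEnd ρ ψ (-1) c J₂)
        (torusMetric hρ k hk) m α : BlockSpace E) = (1 / 2 : ℝ) • (commutator (torusEnd ρ ψ 1 c J₁)
          (torusEnd ρ ψ (-1) c J₂) m (B.inverse α) : BlockSpace E) := rfl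
    have half : ∀ w : BlockSpace E, (1 / 2 : ℝ) • (2 : ℝ) • w = w := fun w => by
      rw [smul_smul]; norm_num
    exact hp.trans ((congrArg (fun w : BlockSpace E => (1 / 2 : ℝ) • w) hc).trans (half _))

end Conclusion

end GKTorus

end

/-! ### The main theorem -/

theorem theorem4p1
    {E : Type*} [NormedAddCommGroup E] [NormedSpace ℝ E] [FiniteDimensional ℝ E] [Nontrivial E]
    {N : Type*} [TopologicalSpace N] [T2Space N] [CompactSpace N] [Nonempty N]
    [ChartedSpace E N] [IsManifold 𝓘(ℝ, E) ∞ N]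
    (J₁ J₂ J₃ : EndField 𝓘(ℝ, E) N) (Ω₁ Ω₂ Ω₃ : DForm 𝓘(ℝ, E) N 2) (k : Metric 𝓘(ℝ, E) N)
    (hN : IsHyperkahler J₁ J₂ J₃ Ω₁ Ω₂ Ω₃ k)
    (Γ : Submodule ℤ (Fin 3 → ℝ)) [DiscreteTopology Γ] [IsZLattice ℝ Γ]
    (a₁ b₂ b₃ : ℝ → ℝ)
    (ha₁ : ContDiffOn ℝ ∞ a₁ (Set.Icc 0 1))
    (hb₂ : ContDiffOn ℝ ∞ b₂ (Set.Icc 0 1))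
    (hb₃ : ContDiffOn ℝ ∞ b₃ (Set.Icc 0 1))
    (hbasis : ∀ t ∈ Set.Icc (0 : ℝ) 1, LinearIndependent ℝ (frame a₁ b₂ b₃ t))
    (hv : vfun b₂ b₃ 1 / ell b₂ b₃ 1 = vfun b₂ b₃ 0 / ell b₂ b₃ 0)
    (hw : wfun b₂ b₃ 1 / ell b₂ b₃ 1 = wfun b₂ b₃ 0 / ell b₂ b₃ 0)
    (hconst : ∃ c : ℝ, c ≠ 0 ∧
      ∀ t ∈ Set.Icc (0 : ℝ) 1, dot (fun s => 1 / ell b₂ b₃ s) t * (1 / a₁ t) = c)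
    (ρ : Torus Γ ≃ₘ^∞⟮𝓘(ℝ, Fin 3 → ℝ), 𝓘(ℝ, Fin 3 → ℝ)⟯ Torus Γ)
    (hρ : ∀ (i : Fin 3) (x : Torus Γ),
      coframe Γ a₁ b₂ b₃ 1 i (ρ x) ∘L mfderiv 𝓘(ℝ, Fin 3 → ℝ) 𝓘(ℝ, Fin 3 → ℝ) ρ x =
        coframe Γ a₁ b₂ b₃ 0 i x)
    (ψ : N ≃ₘ^∞⟮𝓘(ℝ, E), 𝓘(ℝ, E)⟯ N)
    (hψJ₁ : ∀ p, mfderiv 𝓘(ℝ, E) 𝓘(ℝ, E) ψ p ∘L J₁ p =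
      J₁ (ψ p) ∘L mfderiv 𝓘(ℝ, E) 𝓘(ℝ, E) ψ p)
    (hψJ₂ : ∀ p, mfderiv 𝓘(ℝ, E) 𝓘(ℝ, E) ψ p ∘L J₂ p =
      J₂ (ψ p) ∘L mfderiv 𝓘(ℝ, E) 𝓘(ℝ, E) ψ p)
    (hψJ₃ : ∀ p, mfderiv 𝓘(ℝ, E) 𝓘(ℝ, E) ψ p ∘L J₃ p =
      J₃ (ψ p) ∘L mfderiv 𝓘(ℝ, E) 𝓘(ℝ, E) ψ p)
    (hψΩ₁ : pullback ψ Ω₁ = Ω₁) (hψΩ₂ : pullback ψ Ω₂ = Ω₂) (hψΩ₃ : pullback ψ Ω₃ = Ω₃) :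
    ∃ (Ip Im : EndField (model E) (BlockTorus ρ ψ)) (g : Metric (model E) (BlockTorus ρ ψ))
      (Ωp Ωm : DForm (model E) (BlockTorus ρ ψ) 2),
      IsGeneralizedKahler Ip Im g Ωp Ωm ∧
      ¬ IsSplit Ip Im ∧
      (∀ (x : Torus Γ) (t : ℝ) (p : N) (X : TangentSpace 𝓘(ℝ, E) p),
        Ip (fibre ρ ψ x t p) (dfibre ρ ψ x t p X) = dfibre ρ ψ x t p (J₁ p X) ∧
        Im (fibre ρ ψ x t p) (dfibre ρ ψ x t p X) = dfibre ρ ψ x t p (J₂ p X)) ∧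
      (∀ (x : Torus Γ) (t : ℝ) (p : N)
        (α : TangentSpace (model E) (fibre ρ ψ x t p) →L[ℝ] ℝ),
        ∃ X : TangentSpace 𝓘(ℝ, E) p,
          (∀ Y : TangentSpace 𝓘(ℝ, E) p, Ω₃ p ![X, Y] = α (dfibre ρ ψ x t p Y)) ∧
          poissonTensor Ip Im g (fibre ρ ψ x t p) α = -dfibre ρ ψ x t p X) := by
  have hl : ∀ t ∈ Set.Icc (0 : ℝ) 1, 0 < ell b₂ b₃ t := fun t ht =>
    (frame_nondegenerate (hbasis t ht)).2
  have m0 : (0 : ℝ) ∈ Set.Icc (0 : ℝ) 1 := by simp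
  have m1 : (1 : ℝ) ∈ Set.Icc (0 : ℝ) 1 := by simp
  have hal := a_mul_ell_eq hb₂ hb₃ (fun t ht => (hl t ht).ne') hv hconst
  -- This `c` is the logarithm of `κ`, not the constant of `hconst`.
  obtain ⟨c, hc⟩ : ∃ c, Real.exp c = ell b₂ b₃ 1 / ell b₂ b₃ 0 :=
    ⟨_, Real.exp_log (div_pos (hl 1 m1) (hl 0 m0))⟩
  have hsim : ∀ x, IsTwistedSimilarity (Real.exp c)
      (mfderiv 𝓘(ℝ, Fin 3 → ℝ) 𝓘(ℝ, Fin 3 → ℝ) ρ x) := fun x => by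
    rw [hc]
    exact isTwistedSimilarity_of_coframe (frame_nondegenerate (hbasis 0 m0)).1
      (frame_nondegenerate (hbasis 1 m1)).1 (hl 0 m0).ne' (hl 1 m1).ne' hal ρ hρ x
  have h₁ := preservesEnd_of_mfderiv_comp hψJ₁
  have h₂ := preservesEnd_of_mfderiv_comp hψJ₂
  have h₃ := preservesEnd_of_mfderiv_comp hψJ₃
  have hk := preservesBilin_of_pullback hN.complex₁ hN.hermitian₁ h₁ hψΩ₁
  have hsq : ∀ (q : N) (v : E), endAt J₃ q (endAt J₃ q v) = -v := hN.complex₃.sq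
  refine ⟨torusEnd ρ ψ 1 c J₁, torusEnd ρ ψ (-1) c J₂, torusMetric hsim k hk,
    torusForm ρ ψ 1 c Ω₁, torusForm ρ ψ (-1) c Ω₂,
    isGeneralizedKahler_torus hsim hN h₁ h₂ hk, fun hsplit => ?_, fun x t p X => ?_,
    fun x t p α => ?_⟩
  · obtain ⟨p⟩ := ‹Nonempty N›
    set m : BlockTorus ρ ψ := fibre ρ ψ (Torus.mk Γ 0) 0 p
    -- A vanishing commutator would give `2 J₃ v = 0`, hence `v = -J₃ (J₃ v) = 0`.
    obtain ⟨v, hv0⟩ := exists_ne (0 : E)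
    have h0 : (commutator (torusEnd ρ ψ 1 c J₁) (torusEnd ρ ψ (-1) c J₂) m (ofE v) :
        BlockSpace E) = 0 :=
      congrArg (fun T : BlockSpace E →L[ℝ] BlockSpace E => T (ofE v)) (hsplit m)
    have h12 : ∀ v : E, endAt J₁ (base m) (endAt J₂ (base m) v) = endAt J₃ (base m) v :=
      hN.quaternion (base m)
    have h21 : ∀ v : E, endAt J₂ (base m) (endAt J₁ (base m) v) = -endAt J₃ (base m) v :=
      hN.anticommute (base m)
    rw [commutator_torusEnd, h12, h21, sub_neg_eq_add, ← two_smul ℝ] at h0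
    have h1 : (2 : ℝ) • endAt J₃ (base m) v = 0 := congrArg (fun w : BlockSpace E => w.1.2) h0
    have h2 := (smul_eq_zero.1 h1).resolve_left two_ne_zero
    have h3 := hsq (base m) v
    rw [h2, map_zero] at h3
    exact hv0 (neg_eq_zero.1 h3.symm)
  · obtain ⟨n, hb, hd⟩ := exists_dfibre (ψ := ψ) (Real.exp_pos c).ne' hsim x t p
    have key : ∀ (σ : ℝ) (J : EndField 𝓘(ℝ, E) N), PreservesEnd J ψ →
        endAt (torusEnd ρ ψ σ c J) (fibre ρ ψ x t p) (dfibre ρ ψ x t p X) =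
          (dfibre ρ ψ x t p (J p X) : BlockSpace E) := fun σ J hJ => by
      have e : endAt J (base (fibre ρ ψ x t p)) (derivAt ⇑((ψ.toEquiv : Equiv.Perm N) ^ n) p X) =
          derivAt ⇑((ψ.toEquiv : Equiv.Perm N) ^ n) p (endAt J p X) := by
        rw [hb]
        exact (hJ.zpow ψ n p X).symm
      exact (congrArg (endAt (torusEnd ρ ψ σ c J) (fibre ρ ψ x t p)) (hd X)).trans
        ((blockEnd_ofE _ _ _ _ _).trans ((congrArg ofE e).trans (hd (endAt J p X)).symm))
    exact ⟨key 1 J₁ h₁, key (-1) J₂ h₂⟩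
  · obtain ⟨n, hb, hd⟩ := exists_dfibre (ψ := ψ) (Real.exp_pos c).ne' hsim x t p
    obtain ⟨β, hβ, hP⟩ := poissonTensor_torus hsim hN hk (fibre ρ ψ x t p) α
    have hiso := hk.zpow ψ n p
    rw [← hb] at hiso
    set S : E →L[ℝ] E := derivAt ⇑((ψ.toEquiv : Equiv.Perm N) ^ n) p with hS
    -- `S` is an isometry for `k`, hence injective, and bijective in finite dimension.
    have hinj : Function.Injective (S : E →ₗ[ℝ] E) := by
      rw [← LinearMap.ker_eq_bot, LinearMap.ker_eq_bot']
      intro v hv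
      by_contra hv0
      have h1 := bilinAt_pos k p v hv0
      rw [← hiso, show S v = 0 from hv] at h1
      simp at h1
    -- `Ω₃(X, ·) = k(J₃ X, ·)` has to be the restriction of `α`, so `S` must send `J₃ X` to `β`,
    -- that is, `X` to `-J₃ β`.
    obtain ⟨X, hX⟩ := LinearMap.injective_iff_surjective.1 hinj
      (-endAt J₃ (base (fibre ρ ψ x t p)) β)
    replace hX : S X = -endAt J₃ (base (fibre ρ ψ x t p)) β := hX
    have hSJ : S (endAt J₃ p X) = β := by
      rw [hS, h₃.zpow, ← hb, ← hS, hX, map_neg, hsq, neg_neg]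
    refine ⟨X, fun Y => ?_, ?_⟩
    · have e : ∀ Y : E, bilinAt k.inner p (endAt J₃ p X) Y = α (ofE (S Y)) := fun Y => by
        rw [← hiso, hSJ]
        exact hβ _
      have e1 : formAt Ω₃ p ![X, Y] = α (ofE (S Y)) :=
        (hN.hermitian₃.formAt_eq p X Y).trans (e Y)
      have e2 : α (ofE (S Y)) = α (dfibre ρ ψ x t p Y) := congrArg α (hd Y).symm
      exact e1.trans e2
    · refine hP.trans ?_
      have e0 : ofE (S X) = -(ofE (endAt J₃ (base (fibre ρ ψ x t p)) β) : BlockSpace E) := by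
        rw [hX, map_neg]
      exact ((congrArg (fun w : BlockSpace E => -w) ((hd X).trans e0)).trans (neg_neg _)).symm
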